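/- \textbf{Setting.} For $x\in\mathbb R^2$ write $x^\perp=(-x_2,x_1)$, and let $(\cdot,\cdot)$ be the Euclidean inner product. Let $D_1,\dots,D_N\subset\mathbb R^2$ be bounded connected open sets with pairwise disjoint closures, each of whose boundaries $\Gamma_i=\partial D_i$ is a smooth simple closed curve, with outward unit normal $\mathbf n$, arc length $ds$, length $|\Gamma_i|$ and centroid $\mathbf x_i^c=|\Gamma_i|^{-1}\int_{\Gamma_i}\mathbf x\,ds_{\mathbf x}$. Let $$T_{k,m,l}(\mathbf x,\mathbf y)=-\frac1\pi\,\frac{(x_k-y_k)(x_m-y_m)(x_l-y_l)}{|\mathbf x-\mathbf y|^4},\qquad k,m,l\in\{1,2\}.$$ A density is a family $\boldsymbol\mu=(\boldsymbol\mu_1,\dots,\boldsymbol\mu_N)$ of continuous functions $\boldsymbol\mu_i:\Gamma_i\to\mathbb R^2$ (in particular, H\"older continuous ones are allowed). For $\mathbf x\in\Gamma_i$ put (with summation over $l,m\in\{1,2\}$) $$(\mathcal K_{i,j}\boldsymbol\mu_j)_k(\mathbf x)= n_{\mathbf x,l}\int_{\Gamma_j}T_{k,m,l}(\mathbf x,\mathbf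 y)\,\mu_{m,j}(\mathbf y)\,ds_{\mathbf y},$$ where for $j=i$ the right-hand side is understood as a principal value, i.e. as the limit for $\varepsilon\downarrow0$ of the same expression with the integral over $\{\mathbf y\in\Gamma_i:|\mathbf x-\mathbf y|>\varepsilon\}$; put $(\mathcal K\boldsymbol\mu)_i=\sum_{j=1}^N\mathcal K_{i,j}\boldsymbol\mu_j$, and let $\mathbf L=\operatorname{diag}(\mathbf L_1,\dots,\mathbf L_N)$ with $$\mathbf L_i\boldsymbol\mu_i(\mathbf x)=\int_{\Gamma_i}\boldsymbol\mu_i\,ds+(\mathbf x-\mathbf x_i^c)^\perp\int_{\Gamma_i}\bigl((\mathbf y-\mathbf x_i^c)^\perp,\boldsymbol\mu_i(\mathbf y)\bigr)\,ds_{\mathbf y}.$$ \textbf{Lemma.} \label{Lem:equivalenceStokes} Let $\boldsymbol\mu,\boldsymbol\rho$ be densities such that $$\left(\tfrac12\mathbf I+\mathcal K+\mathbf L\right)\boldsymbol\mu=-\left(\tfrac12\mathbf I+\mathcal K\right)\boldsymbol\rho\qquad\text{on }\Gamma=\bigcup_i\Gamma_i .$$ Then (all the principal values exist and) $\boldsymbol\mu$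 solves $$\left(\tfrac12\mathbf I+\mathcal K\right)\boldsymbol\mu=-\left(\tfrac12\mathbf I+\mathcal K\right)\boldsymbol\rho\qquad\text{on }\Gamma$$ and satisfies the $3N$ constraints of zero net force and zero net torque $$\int_{\Gamma_i}\mu_{k,i}\,ds=0\quad(k=1,2),\qquad \int_{\Gamma_i}\bigl((\mathbf x-\mathbf x_i^c)^\perp,\boldsymbol\mu_i(\mathbf x)\bigr)\,ds_{\mathbf x}=0,\qquad i=1,\dots,N.$$ -/

import Mathlib

open Set Filter Topology MeasureTheory
open scoped ContDiff

noncomputable section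

namespace StokesMobility

/-- The Euclidean plane. -/
abbrev Plane : Type := EuclideanSpace ℝ (Fin 2)

/-- `x^⊥ = (-x₂, x₁)`. -/
def perp (x : Plane) : Plane := !₂[-x 1, x 0]

/-- The unit normal on the right-hand side of a regular curve `γ` at parameter `t`. -/
def rightNormal (γ : ℝ → Plane) (t : ℝ) : Plane :=
  ‖deriv γ t‖⁻¹ • -perp (deriv γ t)

/-- A bounded planar region whose boundary is one smooth simple closed curve, together with a
regular, positively oriented, periodic parametrization of that curve. The last two fields say
that the orientation is positive: the right-hand unit normal points out of the region. -/
structure Body where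
  carrier : Set Plane
  isOpen_carrier : IsOpen carrier
  isConnected_carrier : IsConnected carrier
  isBounded_carrier : Bornology.IsBounded carrier
  param : ℝ → Plane
  period : ℝ
  period_pos : 0 < period
  param_smooth : ContDiff ℝ ∞ param
  param_periodic : Function.Periodic param period
  param_injOn : InjOn param (Ico 0 period)
  deriv_param_ne_zero : ∀ t, deriv param t ≠ 0
  frontier_carrier : frontier carrier = range param
  inner_side : ∀ t, ∀ᶠ s in 𝓝[>] (0 : ℝ), param t - s • rightNormal param t ∈ carrier
  outer_side : ∀ t, ∀ᶠ s in 𝓝[>] (0 : ℝ), param t + s • rightNormal param t ∉ closure carrier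

namespace Body

/-- The boundary curve `Γ = ∂D`. -/
def boundary (D : Body) : Set Plane := frontier D.carrier

/-- The outward unit normal to `Γ` at the point `D.param t`. -/
def normal (D : Body) (t : ℝ) : Plane := rightNormal D.param t

/-- The arc length integral `∫_Γ f ds`. -/
def arcIntegral {F : Type*} [NormedAddCommGroup F] [NormedSpace ℝ F] (D : Body)
    (f : Plane → F) : F :=
  ∫ t in (0 : ℝ)..D.period, ‖deriv D.param t‖ • f (D.param t)

/-- The length `|Γ|`. -/
def length (D : Body) : ℝ := D.arcIntegral fun _ => (1 : ℝ)

/-- The centroid `x^c = |Γ|⁻¹ ∫_Γ x ds` of `Γ`. -/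
def centroid (D : Body) : Plane := D.length⁻¹ • D.arcIntegral fun x => x

/-- The total torque `∫_Γ ((y - x^c)^⊥, μ(y)) ds` of a density on `Γ`. -/
def torque (D : Body) (μ : Plane → Plane) : ℝ :=
  D.arcIntegral fun y => inner ℝ (perp (y - D.centroid)) (μ y)

/-- `L μ (x) = ∫_Γ μ ds + (x - x^c)^⊥ ∫_Γ ((y - x^c)^⊥, μ(y)) ds`. -/
def opL (D : Body) (μ : Plane → Plane) (x : Plane) : Plane :=
  D.arcIntegral μ + D.torque μ • perp (x - D.centroid)

end Body

/-- The stresslet `T_{k,m,l}(x,y) = -π⁻¹ (x_k - y_k)(x_m - y_m)(x_l - y_l) / |x - y|⁴`. -/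
def stresslet (k m l : Fin 2) (x y : Plane) : ℝ :=
  -(1 / Real.pi) * ((x k - y k) * (x m - y m) * (x l - y l) / ‖x - y‖ ^ 4)

/-- The vector with components `n_l ∫_Γ T_{k,m,l}(x,y) ρ_m(y) ds_y` (summed over `l`, `m`). -/
def traction (D : Body) (x n : Plane) (ρ : Plane → Plane) : Plane :=
  WithLp.toLp 2 fun k =>
    ∑ l, n l * D.arcIntegral fun y => ∑ m, stresslet k m l x y * ρ y m

/-- The same vector with the integral restricted to the points of `Γ` at distance more than `ε`
from `x`. -/
def truncTraction (D : Body) (x n : Plane) (ρ : Plane → Plane) (ε : ℝ) : Plane :=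
  traction D x n ({y | ε < ‖x - y‖}.indicator ρ)

/-- `v` is the principal value `n_l ⨍_Γ T_{k,m,l}(x,y) ρ_m(y) ds_y`. -/
def HasPV (D : Body) (x n : Plane) (ρ : Plane → Plane) (v : Plane) : Prop :=
  Tendsto (truncTraction D x n ρ) (𝓝[>] 0) (𝓝 v)

/-- `(𝒦_{i,j} ρ)` at the point `x = (B i).param t` of `Γ_i`, for a density `ρ` on `Γ_j`: an
ordinary integral for `i ≠ j` and a principal value integral for `i = j`. -/
def opK {N : ℕ} (B : Fin N → Body) (i j : Fin N) (ρ : Plane → Plane) (t : ℝ) : Plane :=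
  if i = j then
    limUnder (𝓝[>] 0) (truncTraction (B j) ((B i).param t) ((B i).normal t) ρ)
  else
    traction (B j) ((B i).param t) ((B i).normal t) ρ

/-- The `i`-th component of `(½ I + 𝒦) μ`, at the point `x = (B i).param t` of `Γ_i`. -/
def halfAddK {N : ℕ} (B : Fin N → Body) (μ : Fin N → Plane → Plane) (i : Fin N) (t : ℝ) :
    Plane :=
  (1 / 2 : ℝ) • μ i ((B i).param t) + ∑ j, opK B i j (μ j) t

end StokesMobility

end

/-! The range of `½ I + 𝒦` is orthogonal, on each `Γ_i` separately, to every rigid motion `r`, that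
is, every field with `(x - y) · (r x - r y) = 0`. But `L_i μ_i` is itself a rigid motion, and the
equation says that it equals `-(½ I + 𝒦)(μ + ρ)` on `Γ_i`. So it is orthogonal to itself and
vanishes on `Γ_i`. A rigid motion with two distinct zeros is trivial, so net force and net torque
vanish, and the equation loses its `L` term.

For the orthogonality (`integral_inner_boundaryTraction`), put `z = x - y` and pair the kernel
`-(1/π)(n·z)(z·v) z/|z|⁴` with `r(x)`. Rigidity replaces `z·r(x)` by `z·r(y)`, and `(n·z)/|z|² ds`
is the differential `dθ` of the argument of `z`. After Fubini one needs `∫ (z·a)(z·b)/|z|² dθ` for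
fixed `a`, `b`. The quotient is `(a·b)/2` plus the real part of a constant times `z / z̄`, and `d(z
/ z̄) = 2i (z / z̄) dθ` integrates to zero over the closed curve. What remains is `(a·b)/2` times
the total turning around `y`: `π` for `y` on the curve and `0` for `y` outside. Hence the pairing of
`r` with `𝒦_{i,j} σ_j` is `-½ ∫ r·σ_i` for `j = i` and `0` otherwise.

The turning values come from local constancy, vanishing far away, and a jump of `π` on either side
of a boundary point (`turning_sub_turning`). Principal values exist because `dθ/dt` stays bounded
when `y` lies on the curve (`exists_angularSpeed_bound`), so the kernel is bounded. -/

namespace StokesMobility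

/-! ### Simple closed curves in the complex plane and bounds on the angular speed. -/

/-- `g` is a regular `C²` parametrization with period `T` of a simple closed curve. -/
structure IsSimpleClosedCurve (g : ℝ → ℂ) (T : ℝ) : Prop where
  pos : 0 < T
  smooth : ContDiff ℝ 2 g
  periodic : Function.Periodic g T
  inj : ∀ s t, g s = g t → |s - t| < T → s = t
  deriv_ne_zero : ∀ t, deriv g t ≠ 0

/-- The derivative of the argument of `g - y`. -/
noncomputable def angularSpeed (g : ℝ → ℂ) (y : ℂ) (t : ℝ) : ℝ := (deriv g t / (g t - y)).im

/-- The total turning of `g - y` over one period. -/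
noncomputable def turning (g : ℝ → ℂ) (T : ℝ) (y : ℂ) : ℝ := ∫ t in (0 : ℝ)..T, angularSpeed g y t

namespace IsSimpleClosedCurve

variable {g : ℝ → ℂ} {T : ℝ}

lemma hasDerivAt (h : IsSimpleClosedCurve g T) (t : ℝ) : HasDerivAt g (deriv g t) t :=
  (h.smooth.differentiable (by norm_num) t).hasDerivAt

lemma continuous (h : IsSimpleClosedCurve g T) : Continuous g := h.smooth.continuous

lemma contDiff_deriv (h : IsSimpleClosedCurve g T) : ContDiff ℝ 1 (deriv g) :=
  ((contDiff_succ_iff_deriv (n := 1)).1 (by simpa [one_add_one_eq_two] using h.smooth)).2.2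

lemma continuous_deriv (h : IsSimpleClosedCurve g T) : Continuous (deriv g) :=
  h.contDiff_deriv.continuous

lemma periodic_deriv (h : IsSimpleClosedCurve g T) : Function.Periodic (deriv g) T := by
  intro t
  rw [← deriv_comp_add_const g T t]
  congr 1
  exact funext h.periodic

lemma ne_of_mem_Ioo (h : IsSimpleClosedCurve g T) {t₀ t : ℝ} (ht : t ∈ Ioo t₀ (t₀ + T)) :
    g t ≠ g t₀ := fun e => by
  have := h.inj t t₀ e (by rw [abs_of_pos (by linarith [ht.1])]; linarith [ht.2])
  exact ht.1.ne' this

lemma exists_lipschitz_deriv (h : IsSimpleClosedCurve g T) :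
    ∃ C, 0 ≤ C ∧ ∀ s t, ‖deriv g t - deriv g s‖ ≤ C * |t - s| := by
  have hp : Function.Periodic (deriv (deriv g)) T := by
    intro t
    rw [← deriv_comp_add_const (deriv g) T t]
    congr 1
    exact funext h.periodic_deriv
  have hc : Continuous (deriv (deriv g)) := h.contDiff_deriv.continuous_deriv le_rfl
  obtain ⟨C, hC⟩ := (hp.compact_of_continuous h.pos.ne' hc).isBounded.exists_norm_le
  refine ⟨C, (norm_nonneg _).trans (hC _ (mem_range_self 0)), fun s t => ?_⟩
  exact Convex.norm_image_sub_le_of_norm_deriv_le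
    (fun x _ => h.contDiff_deriv.differentiable (by norm_num) x)
    (fun x _ => hC _ (mem_range_self x)) convex_univ (mem_univ s) (mem_univ t)

lemma norm_deriv_mul_sub_le (h : IsSimpleClosedCurve g T) :
    ∃ C, 0 ≤ C ∧ ∀ s t, ‖(t - s) • deriv g t - (g t - g s)‖ ≤ C * (t - s) ^ 2 := by
  obtain ⟨C, hC, hl⟩ := h.exists_lipschitz_deriv
  refine ⟨C, hC, fun s t => ?_⟩
  have := Convex.norm_image_sub_le_of_norm_hasDerivWithin_le (s := uIcc s t) (x := s) (y := t)
    (f := fun x => (x - s) • deriv g t - (g x - g s)) (f' := fun x => deriv g t - deriv g x)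
    (C := C * |t - s|) (fun x _ => by
      have h1 : HasDerivAt (fun x : ℝ => x - s) 1 x := (hasDerivAt_id x).sub_const s
      have h2 := (h1.smul_const (deriv g t)).sub ((h.hasDerivAt x).sub_const (g s))
      rw [one_smul] at h2
      exact h2.hasDerivWithinAt)
    (fun x hx => (hl x t).trans (by gcongr 1; exact abs_sub_right_of_mem_uIcc hx))
    (convex_uIcc s t) left_mem_uIcc right_mem_uIcc
  simpa [mul_assoc, ← pow_two] using this

/-- The difference quotient extends continuously across the diagonal as the mean `m` of `deriv g`
over the segment. It has no zero there by regularity and none elsewhere by injectivity, so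
compactness bounds it below. -/
lemma exists_chord_bound (h : IsSimpleClosedCurve g T) :
    ∃ c, 0 < c ∧ ∀ s t, |t - s| ≤ T / 2 → c * |t - s| ≤ ‖g t - g s‖ := by
  let m : ℝ × ℝ → ℂ := fun p => ∫ u in (0 : ℝ)..1, deriv g (p.1 + u * (p.2 - p.1))
  have hm : Continuous m := by
    apply intervalIntegral.continuous_parametric_intervalIntegral_of_continuous'
    exact h.continuous_deriv.comp (by fun_prop)
  have hmul : ∀ s t, (t - s) • m (s, t) = g t - g s := by
    intro s t
    have := intervalIntegral.smul_integral_comp_add_mul (a := 0) (b := 1) (deriv g) (t - s) s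
    simp only [mul_zero, add_zero, mul_one, add_sub_cancel] at this
    rw [← intervalIntegral.integral_eq_sub_of_hasDerivAt (fun x _ => h.hasDerivAt x)
      (h.continuous_deriv.intervalIntegrable _ _), ← this]
    simp only [m]
    congr 2
    ext u
    rw [mul_comm u]
  let K : Set (ℝ × ℝ) := Icc 0 T ×ˢ Icc (-(T / 2)) (T + T / 2) ∩ {p | |p.2 - p.1| ≤ T / 2}
  have hK : IsCompact K := (isCompact_Icc.prod isCompact_Icc).inter_right
    (isClosed_le (by fun_prop) continuous_const)
  have hT := h.pos
  have hne : K.Nonempty := ⟨(0, 0), by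
    simp only [K, mem_inter_iff, mem_prod, mem_Icc, mem_ofPred_eq, sub_self, abs_zero]
    refine ⟨⟨⟨le_rfl, hT.le⟩, by linarith, by linarith⟩, by linarith⟩⟩
  obtain ⟨p, hpK, hp⟩ := hK.exists_isMinOn hne hm.norm.continuousOn
  have hpos : 0 < ‖m p‖ := by
    rw [norm_pos_iff]
    intro e
    have e2 := hmul p.1 p.2
    rw [show m (p.1, p.2) = 0 from e, smul_zero] at e2
    have e3 := h.inj p.2 p.1 (sub_eq_zero.1 e2.symm) (lt_of_le_of_lt hpK.2 (by linarith))
    have : m p = deriv g p.1 := by simp [m, e3]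
    exact h.deriv_ne_zero p.1 (this ▸ e)
  refine ⟨‖m p‖, hpos, fun s t hst => ?_⟩
  -- Periodicity moves `s` into `[0, T]`; then `t` lands in `[-T/2, 3T/2]`, which is why `K` has
  -- these bounds.
  obtain ⟨n, hn⟩ : ∃ n : ℤ, s - n * T ∈ Icc 0 T := by
    refine ⟨⌊s / T⌋, ?_, ?_⟩
    · have := (le_div_iff₀ hT).1 (Int.floor_le (s / T)); linarith
    · have := (div_lt_iff₀ hT).1 (Int.lt_floor_add_one (s / T)); linarith
  have e : g t - g s = (t - s) • m (s - n * T, t - n * T) := by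
    rw [← h.periodic.sub_int_mul_eq n, ← h.periodic.sub_int_mul_eq (x := s) n, ← hmul]
    congr 1; ring
  rw [e, norm_smul, Real.norm_eq_abs, mul_comm]
  gcongr
  apply hp
  refine ⟨⟨hn, ?_⟩, ?_⟩
  · have := abs_le.1 hst
    constructor <;> simp only <;> linarith [hn.1, hn.2]
  · simpa using hst

/-- Subtracting the real number `1 / (t - s)` leaves the imaginary part of `g' / (g t - g s)`
unchanged and cancels the pole. The numerator is then of second order in `t - s`, and so is the
denominator by the chord bound. -/
lemma exists_angularSpeed_bound (h : IsSimpleClosedCurve g T) :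
    ∃ C, 0 ≤ C ∧ ∀ s t, |angularSpeed g (g s) t| ≤ C := by
  obtain ⟨C, hC, hl⟩ := h.norm_deriv_mul_sub_le
  obtain ⟨c, hc, hcl⟩ := h.exists_chord_bound
  have hT := h.pos
  refine ⟨C / c, by positivity, fun s₀ t => ?_⟩
  -- The translate of `s₀` by a multiple of `T` nearest to `t`, so that the chord bound applies.
  obtain ⟨s, hs, hst⟩ : ∃ s, g s = g s₀ ∧ |t - s| ≤ T / 2 := by
    refine ⟨s₀ + round ((t - s₀) / T) * T, ?_, ?_⟩
    · rw [← h.periodic.sub_int_mul_eq (round ((t - s₀) / T))]; congr 1; ring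
    · have := abs_sub_round ((t - s₀) / T)
      have e : t - (s₀ + round ((t - s₀) / T) * T) = ((t - s₀) / T - round ((t - s₀) / T)) * T := by
        field_simp; ring
      rw [e, abs_mul, abs_of_pos hT]
      nlinarith
  rw [← hs]
  rcases eq_or_ne t s with rfl | hne
  · simp only [angularSpeed, sub_self, div_zero, Complex.zero_im, abs_zero]; positivity
  have hd : 0 < |t - s| := abs_pos.2 (sub_ne_zero.2 hne)
  have hz := hcl s t hst
  have hz0 : 0 < ‖g t - g s‖ := lt_of_lt_of_le (by positivity) hz
  have hz1 : g t - g s ≠ 0 := norm_pos_iff.1 hz0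
  have hd' : ((t - s : ℝ) : ℂ) ≠ 0 := by exact_mod_cast sub_ne_zero.2 hne
  have e : angularSpeed g (g s) t
      = (((t - s) • deriv g t - (g t - g s)) / ((t - s : ℝ) * (g t - g s))).im := by
    have : ((t - s) • deriv g t - (g t - g s)) / ((t - s : ℝ) * (g t - g s))
        = deriv g t / (g t - g s) - (((t - s)⁻¹ : ℝ) : ℂ) := by
      rw [Complex.real_smul, Complex.ofReal_inv]
      field_simp
    rw [this, Complex.sub_im, Complex.ofReal_im, sub_zero, angularSpeed]
  rw [e]
  refine (Complex.abs_im_le_norm _).trans ?_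
  rw [norm_div, norm_mul, Complex.norm_real, Real.norm_eq_abs, div_le_div_iff₀ (by positivity) hc]
  calc _ ≤ C * (t - s) ^ 2 * c := by gcongr; exact hl s t
    _ = C * (|t - s| * (c * |t - s|)) := by rw [← sq_abs]; ring
    _ ≤ _ := by gcongr

lemma measurable_angularSpeed (h : IsSimpleClosedCurve g T) (y : ℂ) :
    Measurable (angularSpeed g y) :=
  Complex.measurable_im.comp
    (h.continuous_deriv.measurable.div (h.continuous.measurable.sub_const y))

lemma continuous_angularSpeed (h : IsSimpleClosedCurve g T) {y : ℂ} (hy : ∀ t, g t ≠ y) :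
    Continuous (angularSpeed g y) :=
  Complex.continuous_im.comp (h.continuous_deriv.div (h.continuous.sub continuous_const)
    fun t => sub_ne_zero.2 (hy t))

lemma periodic_angularSpeed (h : IsSimpleClosedCurve g T) (y : ℂ) :
    Function.Periodic (angularSpeed g y) T := fun t => by
  simp only [angularSpeed, h.periodic t, h.periodic_deriv t]

end IsSimpleClosedCurve

/-! ### Local calculus of the argument and of `z / z̄` along a curve. -/

lemma intervalIntegrable_of_bounded {E : Type*} [NormedAddCommGroup E] {f : ℝ → E} {C a b : ℝ}
    (hf : AEStronglyMeasurable f) (hC : ∀ t, ‖f t‖ ≤ C) : IntervalIntegrable f volume a b := by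
  constructor <;>
  exact Measure.integrableOn_of_bounded (by simp) hf (ae_of_all _ hC)

lemma hasDerivAt_log_ratio {g : ℝ → ℂ} {g' y p : ℂ} {t : ℝ} (hg : HasDerivAt g g' t)
    (hs : (g t - y) / (g t - p) ∈ Complex.slitPlane) :
    HasDerivAt (fun t => Complex.log ((g t - y) / (g t - p)))
      (g' / (g t - y) - g' / (g t - p)) t := by
  have h0 := Complex.slitPlane_ne_zero hs
  have hy : g t - y ≠ 0 := fun e => h0 (by rw [e, zero_div])
  have hp : g t - p ≠ 0 := fun e => h0 (by rw [e, div_zero])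
  convert ((hg.sub_const y).fun_div (hg.sub_const p) hp).clog_real hs using 1
  field_simp

lemma hasDerivAt_arg_ratio {g : ℝ → ℂ} {g' y p : ℂ} {t : ℝ} (hg : HasDerivAt g g' t)
    (hs : (g t - y) / (g t - p) ∈ Complex.slitPlane) :
    HasDerivAt (fun t => Complex.arg ((g t - y) / (g t - p)))
      ((g' / (g t - y)).im - (g' / (g t - p)).im) t := by
  simpa [Function.comp_def, Complex.log_im] using
    Complex.imCLM.hasFDerivAt.comp_hasDerivAt t (hasDerivAt_log_ratio hg hs)

/-- If the ratio were a real `r ≤ 0`, then `a = p + (1 - r)⁻¹ (y - p)` would lie on the excluded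
segment. -/
lemma ratio_mem_slitPlane {a y p : ℂ} (hap : a ≠ p)
    (hσ : ∀ σ ∈ Ioc (0 : ℝ) 1, p + σ * (y - p) ≠ a) : (a - y) / (a - p) ∈ Complex.slitPlane := by
  by_contra hn
  rw [Complex.mem_slitPlane_iff] at hn
  push Not at hn
  set r := ((a - y) / (a - p)).re with hr
  have e : (a - y) / (a - p) = (r : ℂ) := Complex.ext (by simp [hr]) (by simpa using hn.2)
  have hap' : a - p ≠ 0 := sub_ne_zero.2 hap
  rw [div_eq_iff hap'] at e
  have h1 : 0 < 1 - r := by linarith [hn.1]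
  refine hσ (1 - r)⁻¹ ⟨by positivity, inv_le_one_of_one_le₀ (by linarith [hn.1])⟩ ?_
  have h2 : (1 - r : ℂ) ≠ 0 := by exact_mod_cast h1.ne'
  push_cast
  field_simp
  linear_combination -e

lemma tendsto_slope_of_eq {g : ℝ → ℂ} {c : ℂ} {t₀ : ℝ} (hg : HasDerivAt g c t₀) :
    Tendsto (fun t : ℝ => (g t - g t₀) / ((t - t₀ : ℝ) : ℂ)) (𝓝[≠] t₀) (𝓝 c) := by
  refine (hasDerivAt_iff_tendsto_slope.1 hg).congr fun t => ?_
  rw [slope_def_module, Complex.real_smul, Complex.ofReal_inv, div_eq_inv_mul]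

/-- Near `t₀` the chord `g t - g t₀` is `t - t₀` times roughly `c`. A positive factor does not
affect the argument; on the left the factor is negative, which flips the sign in the companion limit
and produces the jump. -/
lemma tendsto_arg_ratio_right {g : ℝ → ℂ} {c y : ℂ} {t₀ : ℝ} (hg : HasDerivAt g c t₀)
    (hc : c ≠ 0) (hw : (g t₀ - y) / c ∈ Complex.slitPlane) :
    Tendsto (fun t => Complex.arg ((g t - y) / (g t - g t₀))) (𝓝[>] t₀)
      (𝓝 (Complex.arg ((g t₀ - y) / c))) := by
  have h1 := (tendsto_slope_of_eq hg).mono_left (nhdsWithin_mono t₀ fun t (ht : t₀ < t) => ht.ne')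
  have h2 : Tendsto (fun t => g t - y) (𝓝[>] t₀) (𝓝 (g t₀ - y)) :=
    (hg.continuousAt.tendsto.sub_const y).mono_left nhdsWithin_le_nhds
  refine ((Complex.continuousAt_arg hw).tendsto.comp (h2.div h1 hc)).congr' ?_
  filter_upwards [self_mem_nhdsWithin] with t (ht : t₀ < t)
  rw [Function.comp_apply, ← Complex.arg_real_mul ((g t - y) / (g t - g t₀)) (sub_pos.2 ht)]
  simp only [Pi.div_apply]
  rw [div_div_eq_mul_div, mul_comm, mul_div_assoc]

lemma tendsto_arg_ratio_left {g : ℝ → ℂ} {c y : ℂ} {t₀ : ℝ} (hg : HasDerivAt g c t₀)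
    (hc : c ≠ 0) (hw : (y - g t₀) / c ∈ Complex.slitPlane) :
    Tendsto (fun t => Complex.arg ((g t - y) / (g t - g t₀))) (𝓝[<] t₀)
      (𝓝 (Complex.arg ((y - g t₀) / c))) := by
  have h1 := (tendsto_slope_of_eq hg).mono_left (nhdsWithin_mono t₀ fun t (ht : t < t₀) => ht.ne)
  have h2 : Tendsto (fun t => y - g t) (𝓝[<] t₀) (𝓝 (y - g t₀)) :=
    (hg.continuousAt.tendsto.const_sub y).mono_left nhdsWithin_le_nhds
  refine ((Complex.continuousAt_arg hw).tendsto.comp (h2.div h1 hc)).congr' ?_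
  filter_upwards [self_mem_nhdsWithin] with t (ht : t < t₀)
  rw [Function.comp_apply, ← Complex.arg_real_mul ((g t - y) / (g t - g t₀)) (sub_pos.2 ht)]
  simp only [Pi.div_apply]
  congr 1
  push_cast
  rw [div_div_eq_mul_div]
  ring

lemma hasDerivAt_div_conj {g : ℝ → ℂ} {g' y : ℂ} {t : ℝ} (hg : HasDerivAt g g' t) (hy : g t ≠ y) :
    HasDerivAt (fun t => (g t - y) / star (g t - y))
      (2 * Complex.I * ((g' / (g t - y)).im * ((g t - y) / star (g t - y)))) t := by
  have hz : g t - y ≠ 0 := sub_ne_zero.2 hy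
  have hz' : star (g t - y) ≠ 0 := star_ne_zero.2 hz
  have h1 := hg.sub_const y
  have h2 := h1.star
  refine (h1.fun_div h2 hz').congr_deriv (Eq.symm ?_)
  have e : 2 * Complex.I * ((g' / (g t - y)).im : ℂ)
      = g' / (g t - y) - star g' / star (g t - y) := by
    rw [← star_div₀, Complex.star_def, Complex.sub_conj]
    push_cast; ring
  rw [← mul_assoc, e]
  field_simp

/-! ### Turning: local constancy, behaviour far away, jump at the curve, and the vanishing integral
of `z / z̄`. -/

namespace IsSimpleClosedCurve

variable {g : ℝ → ℂ} {T : ℝ}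

lemma turning_eq_integral (h : IsSimpleClosedCurve g T) (y : ℂ) (t₀ : ℝ) :
    turning g T y = ∫ t in t₀..(t₀ + T), angularSpeed g y t := by
  have := (h.periodic_angularSpeed y).intervalIntegral_add_eq 0 t₀
  rwa [zero_add] at this

/-- The difference of the two angular speeds has the principal argument of the ratio as a periodic
primitive. -/
lemma turning_eq_of_ratio_mem (h : IsSimpleClosedCurve g T) {y p : ℂ}
    (hs : ∀ t, (g t - y) / (g t - p) ∈ Complex.slitPlane) : turning g T y = turning g T p := by
  have hy : ∀ t, g t ≠ y := fun t e => Complex.slitPlane_ne_zero (hs t) (by simp [e])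
  have hp : ∀ t, g t ≠ p := fun t e => Complex.slitPlane_ne_zero (hs t) (by simp [e])
  have iy := (h.continuous_angularSpeed hy).intervalIntegrable (μ := volume) 0 T
  have ip := (h.continuous_angularSpeed hp).intervalIntegrable (μ := volume) 0 T
  rw [← sub_eq_zero, turning, turning, ← intervalIntegral.integral_sub iy ip]
  simp only [angularSpeed]
  rw [intervalIntegral.integral_eq_sub_of_hasDerivAt
    (fun t _ => hasDerivAt_arg_ratio (h.hasDerivAt t) (hs t)) (iy.sub ip)]
  have : g T = g 0 := by simpa using h.periodic 0
  simp [this]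

lemma turning_eq_zero_of_norm_lt (h : IsSimpleClosedCurve g T) {y : ℂ} (hy : ∀ t, ‖g t‖ < ‖y‖) :
    turning g T y = 0 := by
  have hy0 : y ≠ 0 := norm_pos_iff.1 ((norm_nonneg _).trans_lt (hy 0))
  have hne : ∀ t, g t ≠ y := fun t e => (hy t).ne (by rw [e])
  have hs : ∀ t, 1 + -(g t / y) ∈ Complex.slitPlane := fun t => by
    apply Complex.mem_slitPlane_of_norm_lt_one
    rw [norm_neg, norm_div]
    exact (div_lt_one ((norm_nonneg _).trans_lt (hy 0))).2 (hy t)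
  have hd : ∀ t, HasDerivAt (fun t => (Complex.log (1 + -(g t / y))).im) (angularSpeed g y t) t := by
    intro t
    have h1 := (((h.hasDerivAt t).div_const y).fun_neg.const_add 1).clog_real (hs t)
    have h2 := Complex.imCLM.hasFDerivAt.comp_hasDerivAt t h1
    have e : angularSpeed g y t = Complex.imCLM (-(deriv g t / y) / (1 + -(g t / y))) := by
      rw [angularSpeed, Complex.imCLM_apply]
      congr 1
      have h3 : g t - y ≠ 0 := sub_ne_zero.2 (hne t)
      have h4 := Complex.slitPlane_ne_zero (hs t)
      rw [div_eq_div_iff h3 h4]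
      field_simp
      ring
    rw [e]
    exact h2
  rw [turning, intervalIntegral.integral_eq_sub_of_hasDerivAt (fun t _ => hd t)
    ((h.continuous_angularSpeed hne).intervalIntegrable _ _)]
  have : g T = g 0 := by simpa using h.periodic 0
  simp [this]

lemma isCompact_range (h : IsSimpleClosedCurve g T) : IsCompact (range g) :=
  h.periodic.compact_of_continuous h.pos.ne' h.continuous

lemma eventually_turning_eq (h : IsSimpleClosedCurve g T) {p : ℂ} (hp : ∀ t, g t ≠ p) :
    ∀ᶠ y in 𝓝 p, turning g T y = turning g T p := by
  have hU : (range g)ᶜ ∈ 𝓝 p := h.isCompact_range.isClosed.isOpen_compl.mem_nhds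
    (by rintro ⟨t, ht⟩; exact hp t ht)
  obtain ⟨r, hr, hrU⟩ := Metric.mem_nhds_iff.1 hU
  filter_upwards [Metric.ball_mem_nhds p hr] with y hy
  refine h.turning_eq_of_ratio_mem fun t => ?_
  have h0 : g t - p ≠ 0 := sub_ne_zero.2 (hp t)
  have h1 : r ≤ ‖g t - p‖ := by
    by_contra hlt
    exact hrU (show g t ∈ Metric.ball p r by rw [mem_ball_iff_norm]; linarith) ⟨t, rfl⟩
  have e : (g t - y) / (g t - p) = 1 + -((y - p) / (g t - p)) := by field_simp; ring
  rw [e]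
  apply Complex.mem_slitPlane_of_norm_lt_one
  rw [norm_neg, norm_div, div_lt_one (norm_pos_iff.2 h0)]
  exact (mem_ball_iff_norm.1 hy).trans_le h1

lemma turning_eq_of_isPreconnected (h : IsSimpleClosedCurve g T) {S : Set ℂ}
    (hS : IsPreconnected S) (hd : ∀ t, g t ∉ S) {y p : ℂ} (hy : y ∈ S) (hp : p ∈ S) :
    turning g T y = turning g T p := by
  have := isPreconnected_iff_preconnectedSpace.1 hS
  have hl : IsLocallyConstant fun z : S => turning g T z :=
    (IsLocallyConstant.iff_eventually_eq _).2 fun z =>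
      (continuous_subtype_val.tendsto z).eventually
        (h.eventually_turning_eq fun t e => hd t (e ▸ z.2))
  exact hl.apply_eq_of_preconnectedSpace ⟨y, hy⟩ ⟨p, hp⟩

/-- If the segment from `g t₀` to `y` meets the curve only at `g t₀`, the principal argument of `(g
t - y) / (g t - g t₀)` is a primitive on the open period `(t₀, t₀ + T)`. Only its one-sided limits
at the two ends contribute. -/
lemma turning_sub_turning (h : IsSimpleClosedCurve g T) {t₀ : ℝ} {y : ℂ}
    (hσ : ∀ σ ∈ Ioc (0 : ℝ) 1, ∀ t, g t ≠ g t₀ + σ * (y - g t₀))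
    (h1 : (y - g t₀) / deriv g t₀ ∈ Complex.slitPlane)
    (h2 : (g t₀ - y) / deriv g t₀ ∈ Complex.slitPlane) :
    turning g T y - turning g T (g t₀) = Complex.arg ((y - g t₀) / deriv g t₀)
      - Complex.arg ((g t₀ - y) / deriv g t₀) := by
  have hy : ∀ t, g t ≠ y := fun t => by simpa using hσ 1 (by norm_num) t
  obtain ⟨C, -, hC⟩ := h.exists_angularSpeed_bound
  have iy := (h.continuous_angularSpeed hy).intervalIntegrable (μ := volume) t₀ (t₀ + T)
  have ip := intervalIntegrable_of_bounded (a := t₀) (b := t₀ + T)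
    (h.measurable_angularSpeed (g t₀)).aestronglyMeasurable (hC t₀)
  rw [h.turning_eq_integral y t₀, h.turning_eq_integral (g t₀) t₀,
    ← intervalIntegral.integral_sub iy ip]
  have e := h.periodic t₀
  have hb := tendsto_arg_ratio_left (y := y) (h.hasDerivAt (t₀ + T)) (h.deriv_ne_zero _)
    (by rwa [e, h.periodic_deriv t₀])
  rw [e, h.periodic_deriv t₀] at hb
  refine intervalIntegral.integral_eq_sub_of_hasDerivAt_of_tendsto (by linarith [h.pos])
    (fun t ht => ?_) (iy.sub ip)
    (tendsto_arg_ratio_right (h.hasDerivAt t₀) (h.deriv_ne_zero _) h2) hb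
  exact hasDerivAt_arg_ratio (h.hasDerivAt t) (ratio_mem_slitPlane (h.ne_of_mem_Ioo ht)
    fun σ hs e => hσ σ hs t e.symm)

lemma integral_angularSpeed_mul_div_conj_of_notMem (h : IsSimpleClosedCurve g T) {y : ℂ}
    (hy : ∀ t, g t ≠ y) :
    ∫ t in (0 : ℝ)..T, (angularSpeed g y t : ℂ) * ((g t - y) / star (g t - y)) = 0 := by
  have hc : Continuous fun t => 2 * Complex.I *
      ((angularSpeed g y t : ℂ) * ((g t - y) / star (g t - y))) := by
    have h1 := h.continuous_angularSpeed hy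
    have h2 : Continuous fun t => g t - y := h.continuous.sub continuous_const
    have h3 : Continuous fun t => (g t - y) / star (g t - y) :=
      h2.div h2.star fun t => star_ne_zero.2 (sub_ne_zero.2 (hy t))
    exact continuous_const.mul ((Complex.continuous_ofReal.comp h1).mul h3)
  have := intervalIntegral.integral_eq_sub_of_hasDerivAt (a := 0) (b := T)
    (fun t _ => hasDerivAt_div_conj (h.hasDerivAt t) (hy t)) (hc.intervalIntegrable _ _)
  have e : g T = g 0 := by simpa using h.periodic 0
  rw [intervalIntegral.integral_const_mul, e, sub_self] at this
  exact (mul_eq_zero.1 this).resolve_left (by simp)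

lemma norm_div_star_le (z : ℂ) : ‖z / star z‖ ≤ 1 := by
  rw [norm_div, norm_star]; exact div_self_le_one _

/-- As for points off the curve, but `z / z̄` is now undefined at the ends of the period. Its limits
there agree, because the real factor `t - t₀` cancels between `z` and `z̄` whatever its sign. -/
lemma integral_angularSpeed_mul_div_conj (h : IsSimpleClosedCurve g T) (t₀ : ℝ) :
    ∫ t in (0 : ℝ)..T, (angularSpeed g (g t₀) t : ℂ) *
      ((g t - g t₀) / star (g t - g t₀)) = 0 := by
  obtain ⟨C, hC0, hC⟩ := h.exists_angularSpeed_bound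
  have hm : Measurable fun t => (angularSpeed g (g t₀) t : ℂ) *
      ((g t - g t₀) / star (g t - g t₀)) := by
    have h1 := h.measurable_angularSpeed (g t₀)
    have h2 : Continuous fun t => g t - g t₀ := h.continuous.sub continuous_const
    exact (Complex.measurable_ofReal.comp h1).mul (h2.measurable.div h2.star.measurable)
  have hi : IntervalIntegrable (fun t => 2 * Complex.I * ((angularSpeed g (g t₀) t : ℂ) *
      ((g t - g t₀) / star (g t - g t₀)))) volume t₀ (t₀ + T) := by
    apply IntervalIntegrable.const_mul
    refine intervalIntegrable_of_bounded (C := C * 1) hm.aestronglyMeasurable fun t => ?_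
    rw [norm_mul, Complex.norm_real, Real.norm_eq_abs]
    exact mul_le_mul (hC t₀ t) (norm_div_star_le _) (norm_nonneg _) hC0
  have hper : Function.Periodic (fun t => (angularSpeed g (g t₀) t : ℂ) *
      ((g t - g t₀) / star (g t - g t₀))) T := fun t => by
    simp only [h.periodic_angularSpeed _ t, h.periodic t]
  have hlim : ∀ t₁, g t₁ = g t₀ → Tendsto (fun t => (g t - g t₀) / star (g t - g t₀)) (𝓝[≠] t₁)
      (𝓝 (deriv g t₁ / star (deriv g t₁))) := by
    intro t₁ e
    have h1 := tendsto_slope_of_eq (h.hasDerivAt t₁)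
    refine (h1.div h1.star (star_ne_zero.2 (h.deriv_ne_zero t₁))).congr' ?_
    filter_upwards [self_mem_nhdsWithin] with t ht
    have h2 : ((t - t₁ : ℝ) : ℂ) ≠ 0 := by exact_mod_cast sub_ne_zero.2 ht
    simp only [Pi.div_apply, star_div₀, e]
    rw [Complex.star_def, Complex.conj_ofReal, div_div_div_cancel_right₀ h2]
  have := intervalIntegral.integral_eq_sub_of_hasDerivAt_of_tendsto (by linarith [h.pos])
    (fun t ht => hasDerivAt_div_conj (h.hasDerivAt t) (h.ne_of_mem_Ioo ht)) hi
    ((hlim t₀ rfl).mono_left (nhdsWithin_mono _ fun t (ht : t₀ < t) => ht.ne'))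
    ((hlim (t₀ + T) (h.periodic t₀)).mono_left
      (nhdsWithin_mono _ fun t (ht : t < t₀ + T) => ht.ne))
  rw [intervalIntegral.integral_const_mul, h.periodic_deriv, sub_self] at this
  have h3 := hper.intervalIntegral_add_eq 0 t₀
  rw [zero_add] at h3
  rw [h3]
  exact (mul_eq_zero.1 this).resolve_left (by simp)

end IsSimpleClosedCurve

/-! ### The jump of `π` along the normal, and nearest points. -/

namespace IsSimpleClosedCurve

variable {g : ℝ → ℂ} {T : ℝ}

lemma arg_mul_I_of_pos {r : ℝ} (hr : 0 < r) : Complex.arg (r * Complex.I) = Real.pi / 2 := by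
  rw [Complex.arg_real_mul _ hr, Complex.arg_I]

lemma arg_mul_I_of_neg {r : ℝ} (hr : r < 0) : Complex.arg (r * Complex.I) = -(Real.pi / 2) := by
  have : (r : ℂ) * Complex.I = ((-r : ℝ) : ℂ) * (-Complex.I) := by push_cast; ring
  rw [this, Complex.arg_real_mul _ (neg_pos.2 hr), Complex.arg_neg_I]

lemma turning_sub_turning_of_normal (h : IsSimpleClosedCurve g T) {t₀ r : ℝ} {y : ℂ} (hr : r ≠ 0)
    (hy : y - g t₀ = r * Complex.I * deriv g t₀)
    (hσ : ∀ σ ∈ Ioc (0 : ℝ) 1, ∀ t, g t ≠ g t₀ + σ * (y - g t₀)) :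
    turning g T y - turning g T (g t₀) = Complex.arg (r * Complex.I)
      - Complex.arg ((-r : ℝ) * Complex.I) := by
  have hc := h.deriv_ne_zero t₀
  have e1 : (y - g t₀) / deriv g t₀ = r * Complex.I := by rw [hy]; field_simp
  have e2 : (g t₀ - y) / deriv g t₀ = (-r : ℝ) * Complex.I := by
    rw [← neg_sub y, hy]; push_cast; field_simp
  rw [h.turning_sub_turning hσ, e1, e2]
  · rw [e1, Complex.mem_slitPlane_iff]; right; simpa using hr
  · rw [e2, Complex.mem_slitPlane_iff]; right; simpa using hr

lemma turning_left (h : IsSimpleClosedCurve g T) {t₀ r : ℝ} {y : ℂ} (hr : 0 < r)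
    (hy : y - g t₀ = r * Complex.I * deriv g t₀)
    (hσ : ∀ σ ∈ Ioc (0 : ℝ) 1, ∀ t, g t ≠ g t₀ + σ * (y - g t₀)) :
    turning g T y = turning g T (g t₀) + Real.pi := by
  have := h.turning_sub_turning_of_normal hr.ne' hy hσ
  rw [arg_mul_I_of_pos hr, arg_mul_I_of_neg (neg_lt_zero.2 hr)] at this
  linarith

lemma turning_right (h : IsSimpleClosedCurve g T) {t₀ r : ℝ} {y : ℂ} (hr : r < 0)
    (hy : y - g t₀ = r * Complex.I * deriv g t₀)
    (hσ : ∀ σ ∈ Ioc (0 : ℝ) 1, ∀ t, g t ≠ g t₀ + σ * (y - g t₀)) :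
    turning g T y = turning g T (g t₀) - Real.pi := by
  have := h.turning_sub_turning_of_normal hr.ne hy hσ
  rw [arg_mul_I_of_neg hr, arg_mul_I_of_pos (neg_pos.2 hr)] at this
  linarith

/-- A point off the curve lies on the normal through its nearest point on the curve. -/
lemma exists_nearest (h : IsSimpleClosedCurve g T) {y : ℂ} (hy : ∀ t, g t ≠ y) :
    ∃ t₀ r : ℝ, r ≠ 0 ∧ y - g t₀ = r * Complex.I * deriv g t₀ ∧
      ∀ σ ∈ Ioc (0 : ℝ) 1, ∀ t, g t ≠ g t₀ + σ * (y - g t₀) := by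
  obtain ⟨_, ⟨t₀, rfl⟩, hmin⟩ := h.isCompact_range.exists_isMinOn (range_nonempty g)
    (f := fun z => ‖z - y‖) (by fun_prop)
  have hmin' : ∀ t, ‖g t₀ - y‖ ≤ ‖g t - y‖ := fun t => hmin (mem_range_self t)
  have hc := h.deriv_ne_zero t₀
  have hd := ((h.hasDerivAt t₀).sub_const y).norm_sq
  have hl : IsLocalMin (fun t => ‖g t - y‖ ^ 2) t₀ :=
    Eventually.of_forall fun t => pow_le_pow_left₀ (norm_nonneg _) (hmin' t) 2
  have h0 := hl.hasDerivAt_eq_zero hd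
  -- Stationarity of the squared distance: `y - g t₀` is orthogonal to the tangent.
  have hre : ((y - g t₀) / deriv g t₀).re = 0 := by
    rw [Complex.inner] at h0
    simp only [Complex.mul_re, Complex.sub_re, Complex.sub_im, Complex.conj_re,
      Complex.conj_im] at h0
    rw [Complex.div_re, ← add_div, Complex.sub_re, Complex.sub_im]
    rw [div_eq_zero_iff]; left; linarith
  have e : (y - g t₀) / deriv g t₀ = ((y - g t₀) / deriv g t₀).im * Complex.I := by
    apply Complex.ext <;> simp [hre]
  have hne : y - g t₀ ≠ 0 := sub_ne_zero.2 (hy t₀).symm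
  refine ⟨t₀, ((y - g t₀) / deriv g t₀).im, fun h1 => ?_, ?_, fun σ hσ t ht => ?_⟩
  · rw [h1] at e
    simp [hne, hc] at e
  · rw [← e, div_mul_cancel₀ _ hc]
  -- Such a point would be at distance `(1 - σ) ‖g t₀ - y‖` from `y`, closer than the nearest point.
  · have h2 := hmin' t
    have e3 : g t - y = ((1 - σ : ℝ) : ℂ) * (g t₀ - y) := by rw [ht]; push_cast; ring
    rw [e3, norm_mul, Complex.norm_real, Real.norm_eq_abs, abs_of_nonneg (by linarith [hσ.2])] at h2
    have h3 : 0 < ‖g t₀ - y‖ := norm_pos_iff.2 (sub_ne_zero.2 (hy t₀))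
    nlinarith [hσ.1]

end IsSimpleClosedCurve

/-! ### Turning of a boundary curve around points inside, on and outside its body. -/

/-- The plane as the complex line. -/
noncomputable def toComplex : Plane ≃ₗᵢ[ℝ] ℂ := Complex.orthonormalBasisOneI.repr.symm

lemma toComplex_apply (x : Plane) : toComplex x = x 0 + x 1 * Complex.I := by
  simp [toComplex]

@[simp] lemma toComplex_re (x : Plane) : (toComplex x).re = x 0 := by simp [toComplex_apply]

@[simp] lemma toComplex_im (x : Plane) : (toComplex x).im = x 1 := by simp [toComplex_apply]

lemma toComplex_perp (x : Plane) : toComplex (perp x) = Complex.I * toComplex x := by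
  apply Complex.ext <;> simp [perp]

namespace Body

variable (D : Body)

/-- The boundary parametrization as a complex curve. -/
noncomputable def curve (t : ℝ) : ℂ := toComplex (D.param t)

lemma hasDerivAt_param (t : ℝ) : HasDerivAt D.param (deriv D.param t) t :=
  (D.param_smooth.differentiable (by simp) t).hasDerivAt

lemma hasDerivAt_curve (t : ℝ) : HasDerivAt D.curve (toComplex (deriv D.param t)) t :=
  toComplex.toContinuousLinearEquiv.toContinuousLinearMap.hasFDerivAt.comp_hasDerivAt t
    (D.hasDerivAt_param t)

lemma deriv_curve (t : ℝ) : deriv D.curve t = toComplex (deriv D.param t) :=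
  (D.hasDerivAt_curve t).deriv

lemma norm_deriv_curve (t : ℝ) : ‖deriv D.curve t‖ = ‖deriv D.param t‖ := by
  rw [deriv_curve, LinearIsometryEquiv.norm_map]

lemma isSimpleClosedCurve : IsSimpleClosedCurve D.curve D.period where
  pos := D.period_pos
  smooth := toComplex.toContinuousLinearEquiv.contDiff.comp
    (contDiff_infty.1 D.param_smooth 2)
  periodic t := by simp only [curve, D.param_periodic t]
  inj s t hst hlt := by
    have hT := D.period_pos
    have key : ∀ t, D.param (toIcoMod hT 0 t) = D.param t := fun t => by
      rw [toIcoMod, zsmul_eq_mul]; exact D.param_periodic.sub_int_mul_eq _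
    have hm : ∀ t, toIcoMod hT 0 t ∈ Ico 0 D.period := fun t => by
      simpa using toIcoMod_mem_Ico hT 0 t
    have e := D.param_injOn (hm s) (hm t)
      (by rw [key, key]; exact toComplex.injective hst)
    obtain ⟨n, hn⟩ := (toIcoMod_eq_toIcoMod hT).1 e
    rw [zsmul_eq_mul] at hn
    rw [abs_sub_comm, hn, abs_mul, abs_of_pos hT] at hlt
    have h1 : |(n : ℝ)| < 1 := by
      by_contra hge
      push Not at hge
      nlinarith
    have h2 : n = 0 := by
      rw [← Int.cast_abs] at h1
      exact Int.abs_lt_one_iff.1 (by exact_mod_cast h1)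
    rw [h2] at hn
    simp at hn
    linarith
  deriv_ne_zero t := by
    rw [deriv_curve]
    simpa using D.deriv_param_ne_zero t

lemma toComplex_sub_normal (t s : ℝ) : toComplex (D.param t - s • rightNormal D.param t) =
    D.curve t + (s / ‖deriv D.param t‖ : ℝ) * Complex.I * deriv D.curve t := by
  rw [rightNormal, map_sub, map_smul, map_smul, map_neg, toComplex_perp, deriv_curve, curve]
  simp only [Complex.real_smul]
  push_cast
  ring

lemma param_mem_boundary (t : ℝ) : D.param t ∈ D.boundary := by
  rw [boundary, D.frontier_carrier]; exact mem_range_self t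

lemma param_notMem_carrier (t : ℝ) : D.param t ∉ D.carrier := fun h =>
  (D.isOpen_carrier.frontier_eq ▸ D.param_mem_boundary t : D.param t ∈ closure D.carrier \ D.carrier).2 h

lemma param_mem_closure (t : ℝ) : D.param t ∈ closure D.carrier :=
  frontier_subset_closure (D.param_mem_boundary t)

lemma exists_inner (t : ℝ) : ∃ δ : ℝ, 0 < δ ∧ ∀ s ∈ Ioo 0 δ,
    D.param t - s • rightNormal D.param t ∈ D.carrier := by
  obtain ⟨δ, hδ, h⟩ := mem_nhdsGT_iff_exists_Ioo_subset.1 (D.inner_side t)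
  exact ⟨δ, hδ, h⟩

/-- The turning is constant on the connected carrier, so `x` may be moved to a point just inside
`D.param t` on the normal. Positive orientation puts that point on the left, where the jump is `+π`.
-/
lemma turning_carrier_eq {x : Plane} (hx : x ∈ D.carrier) (t : ℝ) :
    turning D.curve D.period (toComplex x) = turning D.curve D.period (D.curve t) + Real.pi := by
  have h := D.isSimpleClosedCurve
  obtain ⟨δ, hδ, hs⟩ := D.exists_inner t
  have hn : 0 < ‖deriv D.param t‖ := norm_pos_iff.2 (D.deriv_param_ne_zero t)
  have e := D.toComplex_sub_normal t (δ / 2)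
  set y := D.param t - (δ / 2) • rightNormal D.param t
  have hy : y ∈ D.carrier := hs _ ⟨by positivity, by linarith⟩
  rw [h.turning_eq_of_isPreconnected (S := toComplex '' D.carrier)
    (D.isConnected_carrier.isPreconnected.image _ toComplex.continuous.continuousOn) _
    (mem_image_of_mem _ hx) (mem_image_of_mem _ hy)]
  · refine h.turning_left (r := δ / 2 / ‖deriv D.param t‖) (by positivity) (by rw [e]; ring)
      fun σ hσ t' ht' => ?_
    have e2 : D.param t' = D.param t - (σ * (δ / 2)) • rightNormal D.param t := by
      apply toComplex.injective
      rw [toComplex_sub_normal, ← curve, ht', e]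
      push_cast; ring
    refine D.param_notMem_carrier t' (e2 ▸ hs _ ⟨by have := hσ.1; positivity, ?_⟩)
    nlinarith [hσ.2]
  · rintro t' ⟨z, hz, hz'⟩
    exact D.param_notMem_carrier t' (toComplex.injective hz' ▸ hz)

/-- Working from the nearest boundary point of each exterior `y` avoids any connectedness of the
exterior. If `y` were on the left normal, its segment to the curve would start inside the carrier
and cross the frontier before reaching `y`, against the nearest-point property. -/
lemma turning_exterior_eq {y : Plane} (hy : y ∉ closure D.carrier) {x : Plane}
    (hx : x ∈ D.carrier) : turning D.curve D.period (toComplex y) =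
      turning D.curve D.period (toComplex x) - 2 * Real.pi := by
  have h := D.isSimpleClosedCurve
  have hne : ∀ t, D.curve t ≠ toComplex y := fun t e =>
    hy (toComplex.injective e ▸ D.param_mem_closure t)
  obtain ⟨t₀, r, hr, e, hσ⟩ := h.exists_nearest hne
  have hn : 0 < ‖deriv D.param t₀‖ := norm_pos_iff.2 (D.deriv_param_ne_zero t₀)
  rcases lt_or_gt_of_ne hr with hr | hr
  · rw [h.turning_right hr e hσ, D.turning_carrier_eq hx t₀]; ring
  · exfalso
    obtain ⟨δ, hδ, hs⟩ := D.exists_inner t₀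
    let S : Set Plane := (fun σ : ℝ => D.param t₀ + σ • (y - D.param t₀)) '' Ioc 0 1
    have hS : IsPreconnected S := isPreconnected_Ioc.image _ (by fun_prop)
    have hy1 : y ∈ S := ⟨1, by norm_num, by simp⟩
    -- Small enough that the point of the segment is within `δ / 2` of `D.param t₀`, hence in the
    -- carrier.
    set σ := min 1 (δ / 2 / (r * ‖deriv D.param t₀‖)) with hσd
    have hσ0 : 0 < σ := by positivity
    have hσ1 : σ * (r * ‖deriv D.param t₀‖) ≤ δ / 2 := by
      rw [← le_div_iff₀ (by positivity)]; exact min_le_right _ _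
    have hz : D.param t₀ + σ • (y - D.param t₀) ∈ D.carrier := by
      have : D.param t₀ + σ • (y - D.param t₀) =
          D.param t₀ - (σ * (r * ‖deriv D.param t₀‖)) • rightNormal D.param t₀ := by
        apply toComplex.injective
        rw [toComplex_sub_normal, map_add, map_smul, map_sub, ← curve, e, Complex.real_smul]
        rw [← mul_assoc σ, mul_div_assoc, div_self hn.ne']
        push_cast; ring
      rw [this]
      exact hs _ ⟨by positivity, by linarith⟩
    have hw : ∃ w ∈ S, w ∈ frontier D.carrier := by
      by_contra! hn
      obtain ⟨w, -, hw1, hw2⟩ := hS D.carrier (closure D.carrier)ᶜ D.isOpen_carrier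
        isClosed_closure.isOpen_compl
        (fun w hw => or_iff_not_imp_left.2 fun h1 h2 =>
          hn w hw (D.isOpen_carrier.frontier_eq ▸ ⟨h2, h1⟩))
        ⟨_, ⟨σ, ⟨hσ0, min_le_left _ _⟩, rfl⟩, hz⟩ ⟨y, hy1, hy⟩
      exact hw2 (subset_closure hw1)
    obtain ⟨w, ⟨σ', hσ', hw'⟩, hw⟩ := hw
    rw [D.frontier_carrier] at hw
    obtain ⟨t, rfl⟩ := hw
    apply hσ σ' hσ' t
    rw [curve, ← hw', map_add, map_smul, map_sub, Complex.real_smul]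
    rfl

lemma exists_far : ∃ y : Plane, y ∉ closure D.carrier ∧ ∀ t, ‖D.curve t‖ < ‖toComplex y‖ := by
  obtain ⟨R, hR⟩ := D.isBounded_carrier.closure.exists_norm_le
  have hR0 : 0 ≤ R := (norm_nonneg _).trans (hR _ (D.param_mem_closure 0))
  have hy : ‖toComplex.symm ((R + 1 : ℝ) : ℂ)‖ = R + 1 := by
    rw [LinearIsometryEquiv.norm_map, Complex.norm_real, Real.norm_eq_abs,
      abs_of_pos (by linarith)]
  refine ⟨toComplex.symm ((R + 1 : ℝ) : ℂ), fun hc => ?_, fun t => ?_⟩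
  · have := hR _ hc
    rw [hy] at this
    linarith
  · rw [LinearIsometryEquiv.norm_map, hy, curve, LinearIsometryEquiv.norm_map]
    linarith [hR _ (D.param_mem_closure t)]

/-- A far point has turning `0`, and the exterior value is `2π` less than the interior one. -/
lemma turning_carrier {x : Plane} (hx : x ∈ D.carrier) :
    turning D.curve D.period (toComplex x) = 2 * Real.pi := by
  obtain ⟨y, hy, hlt⟩ := D.exists_far
  have h1 := D.turning_exterior_eq hy hx
  rw [D.isSimpleClosedCurve.turning_eq_zero_of_norm_lt hlt] at h1
  linarith

lemma turning_boundary (t : ℝ) : turning D.curve D.period (D.curve t) = Real.pi := by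
  obtain ⟨x, hx⟩ := D.isConnected_carrier.nonempty
  have h1 := D.turning_carrier_eq hx t
  rw [D.turning_carrier hx] at h1
  linarith

lemma turning_exterior {y : Plane} (hy : y ∉ closure D.carrier) :
    turning D.curve D.period (toComplex y) = 0 := by
  obtain ⟨x, hx⟩ := D.isConnected_carrier.nonempty
  rw [D.turning_exterior_eq hy hx, D.turning_carrier hx, sub_self]

end Body

/-! ### The stresslet kernel and the existence of principal values. -/

lemma plane_inner (a b : Plane) : inner ℝ a b = a 0 * b 0 + a 1 * b 1 := by
  simp [PiLp.inner_apply, Fin.sum_univ_two]; ring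

lemma plane_norm_sq (a : Plane) : ‖a‖ ^ 2 = a 0 ^ 2 + a 1 ^ 2 := by
  simp [EuclideanSpace.norm_sq_eq, Fin.sum_univ_two]

lemma perp_continuous : Continuous perp := by
  have : perp = fun x => toComplex.symm (Complex.I * toComplex x) := by
    ext1 x; rw [← toComplex_perp, LinearIsometryEquiv.symm_apply_apply]
  rw [this]
  exact toComplex.symm.continuous.comp (continuous_const.mul toComplex.continuous)

lemma inner_perp_self (x : Plane) : inner ℝ (perp x) x = 0 := by
  rw [plane_inner]; simp [perp]; ring

lemma perp_sub (x y : Plane) : perp (x - y) = perp x - perp y := by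
  apply toComplex.injective
  simp only [map_sub, toComplex_perp, mul_sub]

/-- The vector `n_l T_{k,m,l}(x, y) v_m`. -/
noncomputable def tractionKernel (x n y v : Plane) : Plane :=
  (-(1 / Real.pi) * (inner ℝ n (x - y) * inner ℝ (x - y) v / ‖x - y‖ ^ 4)) • (x - y)

lemma tractionKernel_apply (x n y v : Plane) (k : Fin 2) :
    tractionKernel x n y v k = ∑ l, n l * ∑ m, stresslet k m l x y * v m := by
  simp only [tractionKernel, stresslet, plane_inner, Fin.sum_univ_two, PiLp.smul_apply,
    PiLp.sub_apply, smul_eq_mul]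
  ring

lemma norm_tractionKernel_le (x n y v : Plane) :
    ‖tractionKernel x n y v‖ ≤ ‖n‖ * ‖v‖ / ‖x - y‖ := by
  rcases eq_or_ne x y with rfl | hne
  · simp [tractionKernel]
  have hz : 0 < ‖x - y‖ := norm_pos_iff.2 (sub_ne_zero.2 hne)
  rw [tractionKernel, norm_smul, norm_mul, norm_div, norm_mul, norm_neg,
    norm_pow, norm_norm]
  have h1 := norm_inner_le_norm (𝕜 := ℝ) n (x - y)
  have h2 := norm_inner_le_norm (𝕜 := ℝ) (x - y) v
  have hpi : ‖(1 / Real.pi : ℝ)‖ ≤ 1 := by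
    rw [Real.norm_eq_abs, abs_of_pos (by positivity), div_le_one Real.pi_pos]
    linarith [Real.pi_gt_three]
  calc _ ≤ 1 * (‖n‖ * ‖x - y‖ * (‖x - y‖ * ‖v‖) / ‖x - y‖ ^ 4) * ‖x - y‖ := by gcongr
    _ = _ := by field_simp

namespace Body

variable (D E : Body)

lemma param_continuous : Continuous D.param := D.param_smooth.continuous

lemma deriv_param_continuous : Continuous (deriv D.param) :=
  D.param_smooth.continuous_deriv (by simp)

lemma curve_sub (t : ℝ) (y : Plane) : D.curve t - toComplex y = toComplex (D.param t - y) :=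
  (map_sub toComplex _ _).symm

/-- This is `(n·z) ds = |z|² dθ`, the link between the kernel and the turning. -/
lemma norm_deriv_mul_inner_normal (t : ℝ) (y : Plane) :
    ‖deriv D.param t‖ * inner ℝ (D.normal t) (D.param t - y) =
      angularSpeed D.curve (toComplex y) t * ‖D.param t - y‖ ^ 2 := by
  have hn : ‖deriv D.param t‖ ≠ 0 := norm_ne_zero_iff.2 (D.deriv_param_ne_zero t)
  rw [normal, rightNormal, real_inner_smul_left, mul_inv_cancel_left₀ hn, angularSpeed, curve_sub,
    deriv_curve]
  rcases eq_or_ne (D.param t - y) 0 with e | hne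
  · simp [e]
  have h2 : ‖D.param t - y‖ ^ 2 ≠ 0 := pow_ne_zero 2 (norm_ne_zero_iff.2 hne)
  rw [Complex.div_im, ← sub_div, Complex.normSq_eq_norm_sq, LinearIsometryEquiv.norm_map,
    div_mul_cancel₀ _ h2, plane_inner]
  simp [perp]
  ring

lemma norm_deriv_smul_tractionKernel (t : ℝ) (y v : Plane) :
    ‖deriv D.param t‖ • tractionKernel (D.param t) (D.normal t) y v =
      (-(1 / Real.pi) * (angularSpeed D.curve (toComplex y) t *
        (inner ℝ (D.param t - y) v / ‖D.param t - y‖ ^ 2))) • (D.param t - y) := by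
  rcases eq_or_ne (D.param t - y) 0 with e | hne
  · simp [tractionKernel, e]
  have h2 : ‖D.param t - y‖ ≠ 0 := norm_ne_zero_iff.2 hne
  rw [tractionKernel, smul_smul]
  congr 1
  have := D.norm_deriv_mul_inner_normal t y
  field_simp
  linear_combination -(inner ℝ (D.param t - y) v) * this

lemma norm_tractionKernel_le {C : ℝ} {t : ℝ} {y : Plane}
    (hC : |angularSpeed D.curve (toComplex y) t| ≤ C) (v : Plane) :
    ‖tractionKernel (D.param t) (D.normal t) y v‖ ≤ ‖deriv D.param t‖⁻¹ * (C * ‖v‖) := by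
  have hn : 0 < ‖deriv D.param t‖ := norm_pos_iff.2 (D.deriv_param_ne_zero t)
  rw [← div_eq_inv_mul, le_div_iff₀' hn]
  have h0 : ‖deriv D.param t‖ * ‖tractionKernel (D.param t) (D.normal t) y v‖ =
      ‖‖deriv D.param t‖ • tractionKernel (D.param t) (D.normal t) y v‖ := by
    rw [norm_smul, norm_norm]
  rw [h0, norm_deriv_smul_tractionKernel, norm_smul, norm_mul, norm_mul, norm_neg,
    norm_div (inner ℝ (D.param t - y) v), norm_pow, norm_norm]
  rcases eq_or_ne (D.param t - y) 0 with e | hne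
  · simp only [e, norm_zero, mul_zero]
    exact mul_nonneg ((abs_nonneg _).trans hC) (norm_nonneg _)
  have hz : 0 < ‖D.param t - y‖ := norm_pos_iff.2 hne
  have hC0 : 0 ≤ C := (abs_nonneg _).trans hC
  have hpi : ‖(1 / Real.pi : ℝ)‖ ≤ 1 := by
    rw [Real.norm_eq_abs, abs_of_pos (by positivity), div_le_one Real.pi_pos]
    linarith [Real.pi_gt_three]
  have h2 := norm_inner_le_norm (𝕜 := ℝ) (D.param t - y) v
  calc _ ≤ 1 * (C * (‖D.param t - y‖ * ‖v‖ / ‖D.param t - y‖ ^ 2)) * ‖D.param t - y‖ := by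
        gcongr; exact hC
    _ = _ := by field_simp

lemma intervalIntegrable_arc {F : Type*} [NormedAddCommGroup F] [NormedSpace ℝ F] {f : ℝ → F}
    {C : ℝ} (hf : AEStronglyMeasurable f) (hC : ∀ t, ‖f t‖ ≤ C) :
    IntervalIntegrable (fun t => ‖deriv D.param t‖ • f t) volume 0 D.period := by
  obtain ⟨M, hM⟩ := (D.isSimpleClosedCurve.periodic_deriv.compact_of_continuous
    D.period_pos.ne' D.isSimpleClosedCurve.continuous_deriv).isBounded.exists_norm_le
  refine intervalIntegrable_of_bounded (C := M * C)
    (D.deriv_param_continuous.norm.aestronglyMeasurable.smul hf) fun t => ?_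
  have h1 := hM _ (mem_range_self t)
  rw [norm_smul, norm_norm]
  rw [norm_deriv_curve] at h1
  exact mul_le_mul h1 (hC t) (norm_nonneg _) ((norm_nonneg _).trans h1)

lemma exists_norm_le_of_continuous {F : Type*} [NormedAddCommGroup F] {σ : Plane → F}
    (hσ : Continuous fun t => σ (D.param t)) : ∃ M, 0 ≤ M ∧ ∀ t, ‖σ (D.param t)‖ ≤ M := by
  have hp : Function.Periodic (fun t => σ (D.param t)) D.period := fun t => by
    simp only [D.param_periodic t]
  obtain ⟨M, hM⟩ := (hp.compact_of_continuous D.period_pos.ne' hσ).isBounded.exists_norm_le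
  exact ⟨M, (norm_nonneg _).trans (hM _ (mem_range_self 0)), fun t => hM _ (mem_range_self t)⟩

lemma measurable_tractionKernel (x n : Plane) {v : ℝ → Plane} (hv : Measurable v) :
    Measurable fun t => tractionKernel x n (D.param t) (v t) := by
  have hz : Measurable fun t => x - D.param t := D.param_continuous.measurable.const_sub x
  unfold tractionKernel
  exact ((((hz.const_inner (c := n)).mul (hz.inner hv)).div (hz.norm.pow_const 4)).const_mul _).smul hz

/-- A truncated traction is the integral of the combined kernel. -/
lemma truncTraction_eq (x n : Plane) {σ : Plane → Plane} {ε : ℝ}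
    (hσ : Continuous fun t => σ (D.param t)) (hε : 0 < ε) :
    truncTraction D x n σ ε = D.arcIntegral fun y =>
      tractionKernel x n y ({y | ε < ‖x - y‖}.indicator σ y) := by
  obtain ⟨M, hM0, hM⟩ := D.exists_norm_le_of_continuous hσ
  set v : ℝ → Plane := fun t => {y | ε < ‖x - y‖}.indicator σ (D.param t) with hv
  have hvm : Measurable v := by
    have : v = (D.param ⁻¹' {y | ε < ‖x - y‖}).indicator fun t => σ (D.param t) := by
      ext1 t; simp [hv, Set.indicator]
    rw [this]
    refine hσ.measurable.indicator (D.param_continuous.measurable ?_)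
    exact (isOpen_lt continuous_const (by fun_prop)).measurableSet
  have hvk : ∀ n' t, ‖tractionKernel x n' (D.param t) (v t)‖ ≤ ‖n'‖ * M / ε := by
    intro n' t
    by_cases ht : ε < ‖x - D.param t‖
    · refine (StokesMobility.norm_tractionKernel_le _ _ _ _).trans ?_
      have : ‖v t‖ ≤ M := by simpa [hv, Set.indicator, ht] using hM t
      gcongr
    · have : v t = 0 := by simp [hv, Set.indicator, ht]
      rw [this]
      simp only [tractionKernel, inner_zero_right, mul_zero, zero_div, zero_smul, norm_zero]
      positivity
  have hi : ∀ n', IntervalIntegrable (fun t => ‖deriv D.param t‖ •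
      tractionKernel x n' (D.param t) (v t)) volume 0 D.period := fun n' =>
    D.intervalIntegrable_arc (D.measurable_tractionKernel x n' hvm).aestronglyMeasurable (hvk n')
  have hproj : ∀ n' k, (∫ t in (0 : ℝ)..D.period, ‖deriv D.param t‖ •
      tractionKernel x n' (D.param t) (v t)) k = ∫ t in (0 : ℝ)..D.period,
      ‖deriv D.param t‖ * tractionKernel x n' (D.param t) (v t) k := by
    intro n' k
    have := (EuclideanSpace.proj (ι := Fin 2) (𝕜 := ℝ) k).intervalIntegral_comp_comm
      (hi n')
    simpa using this.symm
  have hik : ∀ n' k, IntervalIntegrable (fun t => ‖deriv D.param t‖ *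
      tractionKernel x n' (D.param t) (v t) k) volume 0 D.period := fun n' k => by
    have hk : IntervalIntegrable (fun t => EuclideanSpace.proj (ι := Fin 2) (𝕜 := ℝ) k
        (‖deriv D.param t‖ • tractionKernel x n' (D.param t) (v t))) volume 0 D.period :=
      ⟨ContinuousLinearMap.integrable_comp _ (hi n').1,
        ContinuousLinearMap.integrable_comp _ (hi n').2⟩
    simpa [Function.comp_def] using hk
  ext k
  -- Taking a basis vector as normal isolates one `l`; its integrability lets the sum over `l` pass
  -- through the integral.
  have hbasis : ∀ l t, ∑ m, stresslet k m l x (D.param t) * v t m =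
      tractionKernel x (EuclideanSpace.single l 1) (D.param t) (v t) k := by
    intro l t
    rw [tractionKernel_apply]
    simp
  simp only [truncTraction, traction, arcIntegral]
  rw [hproj n k]
  simp only [smul_eq_mul]
  calc _ = ∑ l, ∫ t in (0 : ℝ)..D.period, n l * (‖deriv D.param t‖ *
        tractionKernel x (EuclideanSpace.single l 1) (D.param t) (v t) k) := by
        refine Finset.sum_congr rfl fun l _ => ?_
        rw [intervalIntegral.integral_const_mul]
        exact congrArg (n l * ·) (intervalIntegral.integral_congr fun t _ =>
          congrArg (‖deriv D.param t‖ * ·) (hbasis l t))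
    _ = _ := by
        rw [← intervalIntegral.integral_finsetSum fun l _ => (hik _ k).const_mul (n l)]
        refine intervalIntegral.integral_congr fun t _ => ?_
        simp only [tractionKernel_apply x n, ← hbasis, Finset.mul_sum]
        exact Finset.sum_congr rfl fun l _ => Finset.sum_congr rfl fun m _ => by ring

/-- The traction along `D` of a density on `E`, as an absolutely convergent integral. -/
noncomputable def boundaryTraction (σ : Plane → Plane) (t : ℝ) : Plane :=
  E.arcIntegral fun y => tractionKernel (D.param t) (D.normal t) y (σ y)

/-- Dominated convergence: a bounded angular speed makes the kernel bounded, so removing the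
truncation converges to an ordinary integral. -/
lemma hasPV_boundaryTraction {C t : ℝ} (hC : ∀ τ, |angularSpeed D.curve (E.curve τ) t| ≤ C)
    {σ : Plane → Plane} (hσ : Continuous fun τ => σ (E.param τ)) :
    HasPV E (D.param t) (D.normal t) σ (D.boundaryTraction E σ t) := by
  obtain ⟨M, hM0, hM⟩ := E.exists_norm_le_of_continuous hσ
  have hC0 : 0 ≤ C := (abs_nonneg _).trans (hC 0)
  set x := D.param t with hx
  have key : Tendsto (fun ε => E.arcIntegral fun y =>
      tractionKernel x (D.normal t) y ({y | ε < ‖x - y‖}.indicator σ y)) (𝓝[>] 0)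
      (𝓝 (D.boundaryTraction E σ t)) := by
    simp only [boundaryTraction, arcIntegral]
    refine intervalIntegral.tendsto_integral_filter_of_dominated_convergence
      (fun τ => ‖deriv E.param τ‖ • (‖deriv D.param t‖⁻¹ * (C * M))) ?_ ?_ ?_ ?_
    · refine Eventually.of_forall fun ε => ?_
      refine (E.deriv_param_continuous.norm.measurable.smul
        (E.measurable_tractionKernel _ _ ?_)).aestronglyMeasurable
      have : (fun τ => {y | ε < ‖x - y‖}.indicator σ (E.param τ)) =
          (E.param ⁻¹' {y | ε < ‖x - y‖}).indicator fun τ => σ (E.param τ) := by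
        ext1 τ; simp [Set.indicator]
      rw [this]
      exact hσ.measurable.indicator (E.param_continuous.measurable
        (isOpen_lt continuous_const (by fun_prop)).measurableSet)
    · refine Eventually.of_forall fun ε => ae_of_all _ fun τ _ => ?_
      rw [norm_smul, norm_norm, smul_eq_mul]
      refine mul_le_mul_of_nonneg_left ?_ (norm_nonneg _)
      refine (D.norm_tractionKernel_le (hC τ) _).trans ?_
      gcongr
      exact (norm_indicator_le_norm_self _ _).trans (hM τ)
    · exact E.intervalIntegrable_arc aestronglyMeasurable_const (C := ‖deriv D.param t‖⁻¹ * (C * M))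
        fun _ => by rw [Real.norm_eq_abs, abs_of_nonneg (by positivity)]
    · refine ae_of_all _ fun τ _ => ?_
      refine tendsto_const_nhds.congr' ?_
      -- On the diagonal the kernel carries the factor `x - y = 0`, so it is zero for every `ε`.
      rcases eq_or_ne x (E.param τ) with e | hne
      · refine Eventually.of_forall fun ε => ?_
        simp [tractionKernel, ← e, ← hx]
      · have hz : 0 < ‖x - E.param τ‖ := norm_pos_iff.2 (sub_ne_zero.2 hne)
        filter_upwards [mem_nhdsWithin_of_mem_nhds (Iio_mem_nhds hz)] with ε hε
        rw [Set.indicator_of_mem (show E.param τ ∈ {y | ε < ‖x - y‖} from hε)]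
  refine key.congr' ?_
  filter_upwards [self_mem_nhdsWithin] with ε hε
  rw [E.truncTraction_eq x _ hσ hε]

/-- Away from the source curve no truncation is needed. -/
lemma traction_eq_boundaryTraction {C t : ℝ}
    (hC : ∀ τ, |angularSpeed D.curve (E.curve τ) t| ≤ C) (ht : D.param t ∉ E.boundary)
    {σ : Plane → Plane} (hσ : Continuous fun τ => σ (E.param τ)) :
    traction E (D.param t) (D.normal t) σ = D.boundaryTraction E σ t := by
  refine tendsto_nhds_unique (tendsto_const_nhds.congr' ?_) (D.hasPV_boundaryTraction E hC hσ)
  obtain ⟨r, hr, hball⟩ := Metric.mem_nhds_iff.1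
    ((isClosed_frontier (s := E.carrier)).isOpen_compl.mem_nhds ht)
  filter_upwards [mem_nhdsWithin_of_mem_nhds (Iio_mem_nhds hr)] with ε (hε : ε < r)
  have hmem : ∀ τ, E.param τ ∈ {y | ε < ‖D.param t - y‖} := fun τ => by
    by_contra hlt
    have hlt' : ‖D.param t - E.param τ‖ ≤ ε := not_lt.1 hlt
    refine hball ?_ (E.param_mem_boundary τ)
    rw [mem_ball_iff_norm, norm_sub_rev]
    exact hlt'.trans_lt hε
  simp only [truncTraction, traction, arcIntegral, fun τ => Set.indicator_of_mem (hmem τ) σ]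

end Body

/-! ### Pairing a traction with a rigid motion. -/

namespace Body

variable (D E : Body)

/-- With `a`, `b`, `z` read as complex numbers, `(z·a)(z·b)/|z|² = (a·b)/2 + Re (ā b̄ (z / z̄))/2`.
Integrated against `dθ`, the second term vanishes by `h0`. -/
lemma integral_angularSpeed_mul_inner {y : Plane} {C : ℝ}
    (hC : ∀ t, |angularSpeed D.curve (toComplex y) t| ≤ C)
    (h0 : ∫ t in (0 : ℝ)..D.period, (angularSpeed D.curve (toComplex y) t : ℂ) *
      ((D.curve t - toComplex y) / star (D.curve t - toComplex y)) = 0) (a b : Plane) :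
    ∫ t in (0 : ℝ)..D.period, angularSpeed D.curve (toComplex y) t *
      (inner ℝ (D.param t - y) a * inner ℝ (D.param t - y) b / ‖D.param t - y‖ ^ 2) =
      turning D.curve D.period (toComplex y) / 2 * inner ℝ a b := by
  have h := D.isSimpleClosedCurve
  have hm := h.measurable_angularSpeed (toComplex y)
  have hi1 : IntervalIntegrable (angularSpeed D.curve (toComplex y)) volume 0 D.period :=
    intervalIntegrable_of_bounded hm.aestronglyMeasurable hC
  set U : ℝ → ℂ := fun t => (angularSpeed D.curve (toComplex y) t : ℂ) *
      ((D.curve t - toComplex y) / star (D.curve t - toComplex y)) with hU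
  have hz : Continuous fun t => D.curve t - toComplex y := h.continuous.sub continuous_const
  have hi2 : IntervalIntegrable U volume 0 D.period := by
    refine intervalIntegrable_of_bounded (C := C * 1)
      ((Complex.measurable_ofReal.comp hm).mul
        (hz.measurable.div hz.star.measurable)).aestronglyMeasurable fun t => ?_
    rw [norm_mul, Complex.norm_real, Real.norm_eq_abs]
    exact mul_le_mul (hC t) (IsSimpleClosedCurve.norm_div_star_le _) (norm_nonneg _)
      ((abs_nonneg _).trans (hC t))
  set c : ℂ := star (toComplex a) * star (toComplex b) / 2 with hc
  have hi3 : IntervalIntegrable (fun t => Complex.reCLM (c * U t)) volume 0 D.period :=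
    ⟨ContinuousLinearMap.integrable_comp _ (hi2.const_mul c).1,
      ContinuousLinearMap.integrable_comp _ (hi2.const_mul c).2⟩
  have hpt : ∀ t, angularSpeed D.curve (toComplex y) t *
      (inner ℝ (D.param t - y) a * inner ℝ (D.param t - y) b / ‖D.param t - y‖ ^ 2) =
      (inner ℝ a b / 2) * angularSpeed D.curve (toComplex y) t + Complex.reCLM (c * U t) := by
    intro t
    simp only [hU, D.curve_sub]
    rcases eq_or_ne (D.param t - y) 0 with e | hne
    · simp [e, angularSpeed, D.curve_sub]
    set z := D.param t - y
    have hN : z 0 ^ 2 + z 1 ^ 2 ≠ 0 := by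
      rw [← plane_norm_sq]; exact pow_ne_zero 2 (norm_ne_zero_iff.2 hne)
    have hu : toComplex z / star (toComplex z) =
        ⟨(z 0 ^ 2 - z 1 ^ 2) / (z 0 ^ 2 + z 1 ^ 2), 2 * z 0 * z 1 / (z 0 ^ 2 + z 1 ^ 2)⟩ := by
      rw [div_eq_iff (star_ne_zero.2 (by simpa using hne))]
      apply Complex.ext <;> simp <;> field_simp <;> ring
    have hre : (c * ((angularSpeed D.curve (toComplex y) t : ℂ) *
        (toComplex z / star (toComplex z)))).re = angularSpeed D.curve (toComplex y) t *
        ((a 0 * b 0 - a 1 * b 1) / 2 * ((z 0 ^ 2 - z 1 ^ 2) / (z 0 ^ 2 + z 1 ^ 2)) +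
          (a 0 * b 1 + a 1 * b 0) / 2 * (2 * z 0 * z 1 / (z 0 ^ 2 + z 1 ^ 2))) := by
      have hcr : c.re = (a 0 * b 0 - a 1 * b 1) / 2 := by simp [hc]
      have hci : c.im = -(a 0 * b 1 + a 1 * b 0) / 2 := by simp [hc]; ring
      rw [hu, Complex.mul_re, Complex.re_ofReal_mul, Complex.im_ofReal_mul, hcr, hci]
      ring
    rw [Complex.reCLM_apply, hre, plane_inner, plane_inner, plane_inner, plane_norm_sq]
    field_simp
    ring
  simp only [hpt]
  rw [intervalIntegral.integral_add (hi1.const_mul _) hi3, intervalIntegral.integral_const_mul,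
    Complex.reCLM.intervalIntegral_comp_comm (hi2.const_mul c),
    intervalIntegral.integral_const_mul, h0, ← turning]
  simp
  ring

lemma measurable_angularSpeed_prod :
    Measurable fun p : ℝ × ℝ => angularSpeed D.curve (E.curve p.2) p.1 := by
  have h1 := D.isSimpleClosedCurve
  have h2 := E.isSimpleClosedCurve
  unfold angularSpeed
  exact Complex.measurable_im.comp ((h1.continuous_deriv.measurable.comp measurable_fst).div
    ((h1.continuous.measurable.comp measurable_fst).sub
      (h2.continuous.measurable.comp measurable_snd)))

/-- The pairing of the traction along `D` of a density on `E` with an infinitesimal rigid motion,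
when the turning of `D` is the same around all points of `E`. -/
lemma integral_inner_boundaryTraction {C θ : ℝ}
    (hC : ∀ t τ, |angularSpeed D.curve (E.curve τ) t| ≤ C)
    (h0 : ∀ τ, ∫ t in (0 : ℝ)..D.period, (angularSpeed D.curve (E.curve τ) t : ℂ) *
      ((D.curve t - E.curve τ) / star (D.curve t - E.curve τ)) = 0)
    (hθ : ∀ τ, turning D.curve D.period (E.curve τ) = θ) {r σ : Plane → Plane}
    (hr : Continuous r) (hrigid : ∀ x y, inner ℝ (x - y) (r x - r y) = 0)
    (hσ : Continuous fun τ => σ (E.param τ)) :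
    IntervalIntegrable (fun t => ‖deriv D.param t‖ *
      inner ℝ (r (D.param t)) (D.boundaryTraction E σ t)) volume 0 D.period ∧
    ∫ t in (0 : ℝ)..D.period, ‖deriv D.param t‖ *
      inner ℝ (r (D.param t)) (D.boundaryTraction E σ t) =
      -(θ / (2 * Real.pi)) * E.arcIntegral fun y => inner ℝ (r y) (σ y) := by
  obtain ⟨M, hM0, hM⟩ := E.exists_norm_le_of_continuous hσ
  obtain ⟨R, hR0, hR⟩ := E.exists_norm_le_of_continuous (σ := r) (hr.comp E.param_continuous)
  obtain ⟨V, hV⟩ := (E.isSimpleClosedCurve.periodic_deriv.compact_of_continuous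
    E.period_pos.ne' E.isSimpleClosedCurve.continuous_deriv).isBounded.exists_norm_le
  have hC0 : 0 ≤ C := (abs_nonneg _).trans (hC 0 0)
  let F : ℝ → ℝ → ℝ := fun t τ => ‖deriv E.param τ‖ * (-(1 / Real.pi) *
    (angularSpeed D.curve (E.curve τ) t * (inner ℝ (D.param t - E.param τ) (σ (E.param τ)) *
      inner ℝ (D.param t - E.param τ) (r (E.param τ)) / ‖D.param t - E.param τ‖ ^ 2)))
  have hFm : Measurable (Function.uncurry F) := by
    have hz : Measurable fun p : ℝ × ℝ => D.param p.1 - E.param p.2 :=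
      (D.param_continuous.measurable.comp measurable_fst).sub
        (E.param_continuous.measurable.comp measurable_snd)
    have hs : Measurable fun p : ℝ × ℝ => σ (E.param p.2) := hσ.measurable.comp measurable_snd
    have hr' : Measurable fun p : ℝ × ℝ => r (E.param p.2) :=
      (hr.comp E.param_continuous).measurable.comp measurable_snd
    have hE : Measurable fun p : ℝ × ℝ => ‖deriv E.param p.2‖ :=
      E.deriv_param_continuous.norm.measurable.comp measurable_snd
    exact hE.mul (((D.measurable_angularSpeed_prod E).mul
      (((hz.inner hs).mul (hz.inner hr')).div (hz.norm.pow_const 2))).const_mul _)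
  have hFb : ∀ p, ‖Function.uncurry F p‖ ≤ V * (1 * (C * (M * R))) := by
    rintro ⟨t, τ⟩
    have hpi : ‖(-(1 / Real.pi) : ℝ)‖ ≤ 1 := by
      rw [norm_neg, Real.norm_eq_abs, abs_of_pos (by positivity), div_le_one Real.pi_pos]
      linarith [Real.pi_gt_three]
    have hv : ‖deriv E.param τ‖ ≤ V := by
      rw [← E.norm_deriv_curve]; exact hV _ (mem_range_self τ)
    have hq : ‖inner ℝ (D.param t - E.param τ) (σ (E.param τ)) *
        inner ℝ (D.param t - E.param τ) (r (E.param τ)) / ‖D.param t - E.param τ‖ ^ 2‖ ≤ M * R := by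
      rcases eq_or_ne (D.param t - E.param τ) 0 with e | hne
      · simp only [e, inner_zero_left, mul_zero, zero_div, norm_zero]; positivity
      have hz : 0 < ‖D.param t - E.param τ‖ := norm_pos_iff.2 hne
      rw [norm_div, norm_mul, norm_pow, norm_norm, div_le_iff₀ (by positivity)]
      have h1 := norm_inner_le_norm (𝕜 := ℝ) (D.param t - E.param τ) (σ (E.param τ))
      have h2 := norm_inner_le_norm (𝕜 := ℝ) (D.param t - E.param τ) (r (E.param τ))
      calc _ ≤ (‖D.param t - E.param τ‖ * M) * (‖D.param t - E.param τ‖ * R) := by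
            refine mul_le_mul (h1.trans ?_) (h2.trans ?_) (norm_nonneg _) (by positivity)
            · gcongr; exact hM τ
            · gcongr; exact hR τ
        _ = _ := by ring
    simp only [Function.uncurry, F]
    rw [norm_mul, norm_norm, norm_mul, norm_mul (angularSpeed _ _ _)]
    have hV0 := (norm_nonneg _).trans hv
    gcongr
    exact hC t τ
  -- Boundedness on the product of the two period intervals justifies Fubini even when both curves
  -- coincide.
  have hFi : Integrable (Function.uncurry F)
      ((volume.restrict (Ioc 0 D.period)).prod (volume.restrict (Ioc 0 E.period))) :=
    Integrable.of_bound hFm.aestronglyMeasurable _ (ae_of_all _ hFb)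
  have hpt : ∀ t, ‖deriv D.param t‖ * inner ℝ (r (D.param t)) (D.boundaryTraction E σ t) =
      ∫ τ in (0 : ℝ)..E.period, F t τ := by
    intro t
    have hi : IntervalIntegrable (fun τ => ‖deriv E.param τ‖ • tractionKernel (D.param t)
        (D.normal t) (E.param τ) (σ (E.param τ))) volume 0 E.period := by
      refine E.intervalIntegrable_arc (C := ‖deriv D.param t‖⁻¹ * (C * M))
        (E.measurable_tractionKernel _ _ hσ.measurable).aestronglyMeasurable fun τ => ?_
      refine (D.norm_tractionKernel_le (hC t τ) _).trans ?_
      gcongr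
      exact hM τ
    rw [boundaryTraction, arcIntegral, ← innerSL_apply_apply ℝ,
      ← (innerSL ℝ (r (D.param t))).intervalIntegral_comp_comm hi,
      ← intervalIntegral.integral_const_mul]
    refine intervalIntegral.integral_congr fun τ _ => ?_
    simp only [F]
    rw [innerSL_apply_apply, real_inner_smul_right, mul_left_comm, ← real_inner_smul_right,
      D.norm_deriv_smul_tractionKernel, real_inner_smul_right]
    -- Rigidity turns `z·r(x)` into `z·r(y)`, which is constant in the inner integral once the order
    -- is swapped.
    have e := hrigid (D.param t) (E.param τ)
    rw [inner_sub_right, sub_eq_zero] at e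
    rw [real_inner_comm (D.param t - E.param τ) (r (D.param t)), e, ← curve]
    ring
  simp only [hpt]
  rw [intervalIntegrable_iff_integrableOn_Ioc_of_le D.period_pos.le]
  simp only [intervalIntegral.integral_of_le D.period_pos.le,
    intervalIntegral.integral_of_le E.period_pos.le]
  refine ⟨hFi.integral_prod_left, ?_⟩
  rw [integral_integral_swap hFi]
  simp only [← intervalIntegral.integral_of_le D.period_pos.le]
  rw [← intervalIntegral.integral_of_le E.period_pos.le, arcIntegral,
    ← intervalIntegral.integral_const_mul]
  refine intervalIntegral.integral_congr fun τ _ => ?_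
  simp only [F]
  rw [intervalIntegral.integral_const_mul, intervalIntegral.integral_const_mul]
  have := D.integral_angularSpeed_mul_inner (y := E.param τ) (fun t => hC t τ) (h0 τ)
    (σ (E.param τ)) (r (E.param τ))
  rw [← curve, hθ] at this
  rw [this, smul_eq_mul, real_inner_comm]
  field_simp

lemma curve_ne_of_disjoint (hd : Disjoint (closure D.carrier) (closure E.carrier)) (t τ : ℝ) :
    D.curve t ≠ E.curve τ := fun e =>
  hd.le_bot ⟨D.param_mem_closure t, toComplex.injective e ▸ E.param_mem_closure τ⟩

lemma exists_angularSpeed_bound_of_disjoint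
    (hd : Disjoint (closure D.carrier) (closure E.carrier)) :
    ∃ C, ∀ t τ, |angularSpeed D.curve (E.curve τ) t| ≤ C := by
  have h1 := D.isSimpleClosedCurve
  have h2 := E.isSimpleClosedCurve
  obtain ⟨V, hV⟩ := (h1.periodic_deriv.compact_of_continuous
    D.period_pos.ne' h1.continuous_deriv).isBounded.exists_norm_le
  obtain ⟨q, ⟨⟨t₀, ht₀⟩, ⟨τ₀, hτ₀⟩⟩, hmin⟩ :=
    (h1.isCompact_range.prod h2.isCompact_range).exists_isMinOn
      (f := fun p : ℂ × ℂ => ‖p.1 - p.2‖)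
      ((range_nonempty _).prod (range_nonempty _)) (by fun_prop)
  have hd0 : 0 < ‖q.1 - q.2‖ := norm_pos_iff.2
    (sub_ne_zero.2 (ht₀ ▸ hτ₀ ▸ D.curve_ne_of_disjoint E hd t₀ τ₀))
  refine ⟨V / ‖q.1 - q.2‖, fun t τ => (Complex.abs_im_le_norm _).trans ?_⟩
  have hle : ‖q.1 - q.2‖ ≤ ‖D.curve t - E.curve τ‖ :=
    hmin (show (D.curve t, E.curve τ) ∈ _ from ⟨mem_range_self t, mem_range_self τ⟩)
  have hv := hV _ (mem_range_self t)
  have hV0 := (norm_nonneg _).trans hv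
  rw [norm_div]
  gcongr

end Body

/-! ### Rigid motions on one boundary curve. -/

namespace Body

variable (D : Body)

lemma continuous_comp_param {σ : Plane → Plane} (hσ : ContinuousOn σ D.boundary) :
    Continuous fun t => σ (D.param t) :=
  hσ.comp_continuous D.param_continuous D.param_mem_boundary

lemma intervalIntegrable_continuous {F : Type*} [NormedAddCommGroup F] [NormedSpace ℝ F]
    {f : ℝ → F} (hf : Continuous f) :
    IntervalIntegrable (fun t => ‖deriv D.param t‖ • f t) volume 0 D.period :=
  (D.deriv_param_continuous.norm.smul hf).intervalIntegrable _ _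

lemma opL_continuous (μ : Plane → Plane) : Continuous (D.opL μ) := by
  unfold opL
  exact continuous_const.add
    ((perp_continuous.comp (continuous_id.sub continuous_const)).const_smul (D.torque μ))

lemma opL_rigid (μ : Plane → Plane) (x y : Plane) :
    inner ℝ (x - y) (D.opL μ x - D.opL μ y) = 0 := by
  have : D.opL μ x - D.opL μ y = D.torque μ • perp (x - y) := by
    simp only [opL, perp_sub, smul_sub]
    abel
  rw [this, real_inner_smul_right, real_inner_comm, inner_perp_self, mul_zero]

/-- A rigid motion that vanishes on the boundary curve is zero. -/
lemma net_force_and_torque_eq_zero {μ : Plane → Plane} (h : ∀ t, D.opL μ (D.param t) = 0) :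
    D.arcIntegral μ = 0 ∧ D.torque μ = 0 := by
  have hT := D.period_pos
  -- Two distinct zeros suffice: their difference isolates the torque coefficient.
  have hne : D.param (D.period / 2) - D.param 0 ≠ 0 := fun e => by
    have := D.param_injOn ⟨by positivity, by linarith⟩ ⟨le_rfl, hT⟩ (sub_eq_zero.1 e)
    linarith
  have hperp : perp (D.param (D.period / 2) - D.param 0) ≠ 0 := fun e => by
    have := congrArg toComplex e
    rw [toComplex_perp, map_zero] at this
    exact hne (toComplex.map_eq_zero_iff.1 ((mul_eq_zero.1 this).resolve_left Complex.I_ne_zero))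
  have h1 : D.torque μ • perp (D.param (D.period / 2) - D.param 0) = 0 := by
    have e : D.opL μ (D.param (D.period / 2)) - D.opL μ (D.param 0) =
        D.torque μ • perp (D.param (D.period / 2) - D.param 0) := by
      simp only [opL, perp_sub, smul_sub]
      abel
    rw [← e, h, h, sub_zero]
  have h2 : D.torque μ = 0 := (smul_eq_zero.1 h1).resolve_right hperp
  have h3 := h 0
  rw [opL, h2, zero_smul, add_zero] at h3
  exact ⟨h3, h2⟩

lemma eq_zero_of_arcIntegral_norm_sq {f : Plane → Plane} (hf : Continuous f)
    (h : D.arcIntegral (fun x => ‖f x‖ ^ 2) = 0) (t : ℝ) : f (D.param t) = 0 := by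
  have hT := D.period_pos
  have hcont : Continuous fun t => ‖deriv D.param t‖ • ‖f (D.param t)‖ ^ 2 :=
    D.deriv_param_continuous.norm.smul ((hf.comp D.param_continuous).norm.pow 2)
  obtain ⟨s, hs, e⟩ := D.param_periodic.exists_mem_Ico₀ hT t
  rw [e]
  by_contra hne
  refine (intervalIntegral.integral_pos hT hcont.continuousOn
    (fun x _ => by positivity) ⟨s, Ico_subset_Icc_self hs, ?_⟩).ne' h
  have h1 : 0 < ‖deriv D.param s‖ := norm_pos_iff.2 (D.deriv_param_ne_zero s)
  have h2 : 0 < ‖f (D.param s)‖ := norm_pos_iff.2 hne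
  exact mul_pos h1 (by positivity)

end Body

/-! ### The system of bodies: the range of `½ I + 𝒦`. -/

section System

variable {N : ℕ} {B : Fin N → Body}

lemma exists_bound_pair
    (hB : Pairwise fun i j => Disjoint (closure (B i).carrier) (closure (B j).carrier))
    (i j : Fin N) : ∃ C, ∀ t τ, |angularSpeed (B i).curve ((B j).curve τ) t| ≤ C := by
  rcases eq_or_ne i j with rfl | hij
  · obtain ⟨C, -, hC⟩ := (B i).isSimpleClosedCurve.exists_angularSpeed_bound
    exact ⟨C, fun t τ => hC τ t⟩
  · exact (B i).exists_angularSpeed_bound_of_disjoint (B j) (hB hij)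

lemma opK_eq_boundaryTraction
    (hB : Pairwise fun i j => Disjoint (closure (B i).carrier) (closure (B j).carrier))
    (i j : Fin N) {σ : Plane → Plane} (hσ : ContinuousOn σ (B j).boundary) (t : ℝ) :
    opK B i j σ t = (B i).boundaryTraction (B j) σ t := by
  obtain ⟨C, hC⟩ := exists_bound_pair hB i j
  have hc := (B j).continuous_comp_param hσ
  rw [opK]
  split_ifs with hij
  · exact ((B i).hasPV_boundaryTraction (B j) (hC t) hc).limUnder_eq
  · exact (B i).traction_eq_boundaryTraction (B j) (hC t) (fun hmem =>
      (hB hij).le_bot ⟨(B i).param_mem_closure t, frontier_subset_closure hmem⟩) hc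

lemma integral_inner_opK
    (hB : Pairwise fun i j => Disjoint (closure (B i).carrier) (closure (B j).carrier))
    (i j : Fin N) {σ r : Plane → Plane} (hσ : ContinuousOn σ (B j).boundary)
    (hr : Continuous r) (hrigid : ∀ x y, inner ℝ (x - y) (r x - r y) = 0) :
    IntervalIntegrable (fun t => ‖deriv (B i).param t‖ *
      inner ℝ (r ((B i).param t)) (opK B i j σ t)) volume 0 (B i).period ∧
    ∫ t in (0 : ℝ)..(B i).period, ‖deriv (B i).param t‖ *
      inner ℝ (r ((B i).param t)) (opK B i j σ t) =
      if i = j then -(1 / 2) * (B i).arcIntegral fun y => inner ℝ (r y) (σ y) else 0 := by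
  obtain ⟨C, hC⟩ := exists_bound_pair hB i j
  have hc := (B j).continuous_comp_param hσ
  simp only [opK_eq_boundaryTraction hB i j hσ]
  have hi := (B i).isSimpleClosedCurve
  split_ifs with hij
  · subst hij
    -- Turning `π` on the curve itself gives the factor `-π/(2π) = -½`, which cancels the `½ I`
    -- term.
    have := (B i).integral_inner_boundaryTraction (B i) hC
      hi.integral_angularSpeed_mul_div_conj (B i).turning_boundary hr hrigid hc
    refine ⟨this.1, this.2.trans ?_⟩
    have := Real.pi_ne_zero
    congr 1
    field_simp
  -- The other curves lie outside the closure of body `i`, where the turning is `0`.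
  · have := (B i).integral_inner_boundaryTraction (B j) (θ := 0) hC
      (fun τ => hi.integral_angularSpeed_mul_div_conj_of_notMem
        fun t => (B i).curve_ne_of_disjoint (B j) (hB hij) t τ)
      (fun τ => (B i).turning_exterior fun hmem =>
        (hB hij).le_bot ⟨hmem, (B j).param_mem_closure τ⟩) hr hrigid hc
    refine ⟨this.1, this.2.trans ?_⟩
    simp

/-- The range of `½ I + 𝒦` is orthogonal to the infinitesimal rigid motions of each body. -/
lemma integral_inner_halfAddK
    (hB : Pairwise fun i j => Disjoint (closure (B i).carrier) (closure (B j).carrier))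
    {σ : Fin N → Plane → Plane} (hσ : ∀ j, ContinuousOn (σ j) (B j).boundary) (i : Fin N)
    {r : Plane → Plane} (hr : Continuous r)
    (hrigid : ∀ x y, inner ℝ (x - y) (r x - r y) = 0) :
    IntervalIntegrable (fun t => ‖deriv (B i).param t‖ *
      inner ℝ (r ((B i).param t)) (halfAddK B σ i t)) volume 0 (B i).period ∧
    ∫ t in (0 : ℝ)..(B i).period, ‖deriv (B i).param t‖ *
      inner ℝ (r ((B i).param t)) (halfAddK B σ i t) = 0 := by
  have hK := fun j => integral_inner_opK hB i j (hσ j) hr hrigid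
  have hi0 : IntervalIntegrable (fun t => ‖deriv (B i).param t‖ •
      inner ℝ (r ((B i).param t)) (σ i ((B i).param t))) volume 0 (B i).period :=
    (B i).intervalIntegrable_continuous
      ((hr.comp (B i).param_continuous).inner ((B i).continuous_comp_param (hσ i)))
  have hs : IntervalIntegrable (fun t => ∑ j, ‖deriv (B i).param t‖ *
      inner ℝ (r ((B i).param t)) (opK B i j (σ j) t)) volume 0 (B i).period := by
    have := IntervalIntegrable.sum Finset.univ fun j _ => (hK j).1
    simpa [Finset.sum_fn] using this
  have hpt : ∀ t, ‖deriv (B i).param t‖ *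
      inner ℝ (r ((B i).param t)) (halfAddK B σ i t) =
      (1 / 2) * (‖deriv (B i).param t‖ • inner ℝ (r ((B i).param t)) (σ i ((B i).param t))) +
      ∑ j, ‖deriv (B i).param t‖ * inner ℝ (r ((B i).param t)) (opK B i j (σ j) t) := by
    intro t
    rw [halfAddK, inner_add_right, real_inner_smul_right, inner_sum, mul_add, Finset.mul_sum,
      smul_eq_mul]
    ring
  simp only [hpt]
  refine ⟨(hi0.const_mul _).add hs, ?_⟩
  rw [intervalIntegral.integral_add (hi0.const_mul _) hs, intervalIntegral.integral_const_mul,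
    intervalIntegral.integral_finsetSum fun j _ => (hK j).1]
  simp only [fun j => (hK j).2]
  rw [Finset.sum_ite_eq Finset.univ i, if_pos (Finset.mem_univ i), Body.arcIntegral]
  ring

end System

end StokesMobility

/-! ### The lemma. -/

theorem mainTheorem7 {N : ℕ} (B : Fin N → StokesMobility.Body)
    (hB : Pairwise fun i j => Disjoint (closure (B i).carrier) (closure (B j).carrier))
    (μ ρ : Fin N → StokesMobility.Plane → StokesMobility.Plane)
    (hμ : ∀ i, ContinuousOn (μ i) (B i).boundary)
    (hρ : ∀ i, ContinuousOn (ρ i) (B i).boundary)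
    (hsol : ∀ i t,
      StokesMobility.halfAddK B μ i t + (B i).opL (μ i) ((B i).param t) =
        -StokesMobility.halfAddK B ρ i t) :
    (∀ i t,
      (∃ v, StokesMobility.HasPV (B i) ((B i).param t) ((B i).normal t) (μ i) v) ∧
      (∃ v, StokesMobility.HasPV (B i) ((B i).param t) ((B i).normal t) (ρ i) v)) ∧
    (∀ i t, StokesMobility.halfAddK B μ i t = -StokesMobility.halfAddK B ρ i t) ∧
    (∀ i, ∀ k : Fin 2, (B i).arcIntegral (fun x => μ i x k) = 0) ∧
    (∀ i, (B i).arcIntegral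
      (fun x => inner ℝ (StokesMobility.perp (x - (B i).centroid)) (μ i x)) = 0) := by
  -- Test the equation on `Γ_i` with the rigid motion `L_i μ_i` itself: both `½ I + 𝒦` terms
  -- integrate to zero, leaving `∫ |L_i μ_i|² ds = 0`.
  have hL : ∀ i t, (B i).opL (μ i) ((B i).param t) = 0 := by
    intro i
    refine (B i).eq_zero_of_arcIntegral_norm_sq ((B i).opL_continuous (μ i)) ?_
    have h1 := StokesMobility.integral_inner_halfAddK hB hμ i
      ((B i).opL_continuous (μ i)) ((B i).opL_rigid (μ i))
    have h2 := StokesMobility.integral_inner_halfAddK hB hρ i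
      ((B i).opL_continuous (μ i)) ((B i).opL_rigid (μ i))
    have hpt : ∀ t, ‖deriv (B i).param t‖ • ‖(B i).opL (μ i) ((B i).param t)‖ ^ 2 =
        -(‖deriv (B i).param t‖ * inner ℝ ((B i).opL (μ i) ((B i).param t))
          (StokesMobility.halfAddK B μ i t) +
        ‖deriv (B i).param t‖ * inner ℝ ((B i).opL (μ i) ((B i).param t))
          (StokesMobility.halfAddK B ρ i t)) := by
      intro t
      rw [← mul_add, ← inner_add_right, ← mul_neg, ← inner_neg_right, smul_eq_mul,
        ← real_inner_self_eq_norm_sq]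
      congr 2
      rw [neg_add_rev, ← hsol i t]
      abel
    simp only [StokesMobility.Body.arcIntegral, hpt]
    rw [intervalIntegral.integral_neg, intervalIntegral.integral_add h1.1 h2.1, h1.2, h2.2]
    simp
  refine ⟨fun i t => ?_, fun i t => ?_, fun i k => ?_,
    fun i => ((B i).net_force_and_torque_eq_zero (hL i)).2⟩
  · obtain ⟨C, hC⟩ := StokesMobility.exists_bound_pair hB i i
    exact ⟨⟨_, (B i).hasPV_boundaryTraction (B i) (hC t) ((B i).continuous_comp_param (hμ i))⟩,
      ⟨_, (B i).hasPV_boundaryTraction (B i) (hC t) ((B i).continuous_comp_param (hρ i))⟩⟩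
  · rw [← hsol i t, hL, add_zero]
  · have h1 := (EuclideanSpace.proj (ι := Fin 2) (𝕜 := ℝ) k).intervalIntegral_comp_comm
      ((B i).intervalIntegrable_continuous ((B i).continuous_comp_param (hμ i)))
    have h2 := ((B i).net_force_and_torque_eq_zero (hL i)).1
    simp only [StokesMobility.Body.arcIntegral] at h2
    rw [h2, map_zero] at h1
    simpa [StokesMobility.Body.arcIntegral] using h1
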